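/- All vector spaces are over $\mathbb Q$ and signs follow the Koszul convention. Let $(\land V,d)$ be a commutative differential graded algebra which is free as a graded commutative algebra on a graded vector space $V=V^{\ge 2}$ of finite type, and whose cohomology $H=H(\land V,d)$ is a Poincaré duality algebra of formal dimension $m$ (for instance a Sullivan model of a simply connected space $M$ whose rational cohomology satisfies Poincaré duality in dimension $m$). Let $u:\land V\to\mathbb Q$ be a cycle of degree $m$ in $\mathrm{Hom}(\land V,\mathbb Q)$ representing the fundamental class, so that $([x],[y])\mapsto u(xy)$ is a nondegenerate pairing on the finite dimensional space $H$. Choose homogeneous cocycles $a_i$ and $a_i^{\#}$ in $\land V$ whose classes form a basis of $H$ and its Poincaré dual basis, $u(a_i a_j^{\#})=\delta_{ij}$, and put $$T=\sum_i(-1)^{|a_i|}a_i\otimes a_i^{\#}\in\land V\otimes\land V',$$ a cocycle of degree $m$, where $(\land V',d)$ is a copy of $(\land V,d)$ and $R=(\land V,d)\otimes(\land V',d)$. Let $P=(\land V\otimes\land V'\otimes\land\bar V,D)$ be a relative Sullivan model of the multiplication $\mu:R\to(\land V,d)$: a relative Sullivan algebra $i:R\to P$ with $\bar V=\bar V^{\ge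 1}$, together with a quasi-isomorphism of commutative differential graded algebras $\varphi:P\to(\land V,d)$ such that $\varphi\circ i=\mu$. Then: (1) There exists, and it is unique up to homotopy, a morphism of differential graded $R$-modules $f:P\to R$ of degree $m$ (that is, $f(rx)=(-1)^{m|r|}rf(x)$ and $df=(-1)^m fD$) whose restriction to $R$ induces in cohomology the multiplication by $T$: $[f(i(z))]=[T][z]$ for every cocycle $z\in R$. Here $f$ and $g$ are homotopic if $f-g=dh-(-1)^{m-1}hD$ for some $R$-linear map $h:P\to R$ of degree $m-1$. (2) $\mathrm{Ext}^m_{\land V\otimes\land V'}(\land V,\land V\otimes\land V')\cong\mathbb Q$, where $\land V$ is an $R$-module through $\mu$: one has $H^m(\mathrm{Hom}_R(P,R))\cong\mathbb Q$, and $H^m(\mathrm{Hom}_R(Q,R))\cong\mathbb Q$ for every semifree resolution $Q\to\land V$ of differential graded $R$-modules. -/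

import Mathlib

open scoped TensorProduct DirectSum

universe u v w x

/-! ### Commutative differential graded algebras over `ℚ` -/

/-- A commutative differential graded algebra over `ℚ`, with differential of degree `+1`. The signs
are the Koszul signs: `p.negOnePow` is `(-1)^p`. -/
structure CDGA where
  carrier : Type u
  [ring : Ring carrier]
  [algebra : Algebra ℚ carrier]
  /-- the homogeneous components -/
  deg : ℤ → Submodule ℚ carrier
  [graded : GradedAlgebra deg]
  /-- the differential -/
  d : carrier →ₗ[ℚ] carrier
  d_mem : ∀ {n : ℤ} {x : carrier}, x ∈ deg n → d x ∈ deg (n + 1)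
  d_d : ∀ x : carrier, d (d x) = 0
  leibniz : ∀ {p : ℤ} {x : carrier}, x ∈ deg p → ∀ y : carrier,
    d (x * y) = d x * y + p.negOnePow • (x * d y)
  comm : ∀ {p q : ℤ} {x y : carrier}, x ∈ deg p → y ∈ deg q →
    x * y = (p * q).negOnePow • (y * x)

instance : CoeSort CDGA.{u} (Type u) := ⟨CDGA.carrier⟩

attribute [instance] CDGA.ring CDGA.algebra CDGA.graded

/-- A morphism of commutative differential graded algebras. -/
structure CDGA.Hom (A : CDGA.{u}) (B : CDGA.{v}) extends A.carrier →ₐ[ℚ] B.carrier where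
  map_deg : ∀ {n : ℤ} {x : A}, x ∈ A.deg n → toFun x ∈ B.deg n
  map_d : ∀ x : A, toFun (A.d x) = B.d (toFun x)

instance (A : CDGA.{u}) (B : CDGA.{v}) : CoeFun (A.Hom B) (fun _ => A → B) :=
  ⟨fun f => f.toAlgHom⟩

/-- The identity morphism. -/
def CDGA.Hom.id (A : CDGA.{u}) : A.Hom A where
  toAlgHom := AlgHom.id ℚ A
  map_deg h := h
  map_d _ := rfl

/-- A linear map `f` between spaces with differentials `d`, `d'` induces a bijection
`ker d / im d → ker d' / im d'`: it is injective and surjective on classes. (Used only for maps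
which commute with the differentials.) -/
def IsQuasiIso {X : Type u} {Y : Type v} [AddCommGroup X] [Module ℚ X] [AddCommGroup Y] [Module ℚ Y]
    (d : X →ₗ[ℚ] X) (d' : Y →ₗ[ℚ] Y) (f : X → Y) : Prop :=
  (∀ x, d x = 0 → f x ∈ LinearMap.range d' → x ∈ LinearMap.range d) ∧
  (∀ y, d' y = 0 → ∃ x, d x = 0 ∧ y - f x ∈ LinearMap.range d')

/-- The (total) cohomology `H(A) = ker d / im d`. -/
abbrev CDGA.Cohomology (A : CDGA.{u}) : Type u :=
  LinearMap.ker A.d ⧸ (LinearMap.range A.d).submoduleOf (LinearMap.ker A.d)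

/-- The cohomology class of a cocycle. -/
def CDGA.cls (A : CDGA.{u}) (x : A) (hx : A.d x = 0) : A.Cohomology :=
  Submodule.Quotient.mk ⟨x, LinearMap.mem_ker.2 hx⟩

/-! ### The tensor product of two commutative differential graded algebras -/

namespace CDGA

/-- The sign involution `x ↦ (-1)^{|x|} x`. -/
noncomputable def sgn (A : CDGA.{u}) : A →ₗ[ℚ] A :=
  DirectSum.toModule ℚ ℤ A (fun n => n.negOnePow • (A.deg n).subtype) ∘ₗ
    (DirectSum.decomposeLinearEquiv A.deg).toLinearMap

theorem sgn_of_mem (A : CDGA.{u}) {n : ℤ} {x : A} (hx : x ∈ A.deg n) :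
    A.sgn x = n.negOnePow • x := by
  lift x to A.deg n using hx
  simp [sgn]

variable (A : CDGA.{u}) (B : CDGA.{v})

/-- The degree `n` component of `A ⊗ B`, spanned by the `a ⊗ b` with `|a| + |b| = n`. -/
noncomputable def tensorDeg (n : ℤ) : Submodule ℚ (A.deg ᵍ⊗[ℚ] B.deg) :=
  Submodule.span ℚ {z | ∃ (p q : ℤ) (a : A) (b : B), a ∈ A.deg p ∧ b ∈ B.deg q ∧ p + q = n ∧
    z = a ᵍ⊗ₜ[ℚ] b}

/-- The differential `d (a ⊗ b) = d a ⊗ b + (-1)^{|a|} a ⊗ d b`. -/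
noncomputable def tensorD : (A.deg ᵍ⊗[ℚ] B.deg) →ₗ[ℚ] (A.deg ᵍ⊗[ℚ] B.deg) :=
  (GradedTensorProduct.of ℚ A.deg B.deg).toLinearMap ∘ₗ
    (TensorProduct.map A.d LinearMap.id + TensorProduct.map A.sgn B.d) ∘ₗ
      (GradedTensorProduct.of ℚ A.deg B.deg).symm.toLinearMap

variable {A B}

theorem add_tmul (a a' : A) (b : B) :
    ((a + a') ᵍ⊗ₜ[ℚ] b : A.deg ᵍ⊗[ℚ] B.deg) = a ᵍ⊗ₜ[ℚ] b + a' ᵍ⊗ₜ[ℚ] b :=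
  TensorProduct.add_tmul a a' b

theorem tmul_add (a : A) (b b' : B) :
    (a ᵍ⊗ₜ[ℚ] (b + b') : A.deg ᵍ⊗[ℚ] B.deg) = a ᵍ⊗ₜ[ℚ] b + a ᵍ⊗ₜ[ℚ] b' :=
  TensorProduct.tmul_add a b b'

theorem zero_tmul (b : B) : ((0 : A) ᵍ⊗ₜ[ℚ] b : A.deg ᵍ⊗[ℚ] B.deg) = 0 :=
  TensorProduct.zero_tmul A b

theorem tmul_zero (a : A) : (a ᵍ⊗ₜ[ℚ] (0 : B) : A.deg ᵍ⊗[ℚ] B.deg) = 0 :=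
  TensorProduct.tmul_zero B a

theorem smul_tmul (c : ℚ) (a : A) (b : B) :
    ((c • a) ᵍ⊗ₜ[ℚ] b : A.deg ᵍ⊗[ℚ] B.deg) = c • (a ᵍ⊗ₜ[ℚ] b) :=
  TensorProduct.smul_tmul' c a b

theorem units_smul_tmul (c : ℤˣ) (a : A) (b : B) :
    ((c • a) ᵍ⊗ₜ[ℚ] b : A.deg ᵍ⊗[ℚ] B.deg) = c • (a ᵍ⊗ₜ[ℚ] b) := by
  rcases Int.units_eq_one_or c with e | e <;> rw [e]
  · simp
  · simpa using smul_tmul (-1) a b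

theorem tmul_units_smul (c : ℤˣ) (a : A) (b : B) :
    (a ᵍ⊗ₜ[ℚ] (c • b) : A.deg ᵍ⊗[ℚ] B.deg) = c • (a ᵍ⊗ₜ[ℚ] b) := by
  rcases Int.units_eq_one_or c with e | e <;> rw [e]
  · simp
  · rw [← units_smul_tmul]
    have h : ((-1 : ℚ) • a) ⊗ₜ[ℚ] b = a ⊗ₜ[ℚ] ((-1 : ℚ) • b) := TensorProduct.smul_tmul (-1) a b
    simp only [neg_smul, one_smul, Units.neg_smul] at h ⊢
    exact h.symm

theorem tmul_mem {p q : ℤ} {a : A} {b : B} (ha : a ∈ A.deg p) (hb : b ∈ B.deg q) :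
    (a ᵍ⊗ₜ[ℚ] b : A.deg ᵍ⊗[ℚ] B.deg) ∈ tensorDeg A B (p + q) :=
  Submodule.subset_span ⟨p, q, a, b, ha, hb, rfl, rfl⟩

theorem tmul_mem' {p q n : ℤ} {a : A} {b : B} (ha : a ∈ A.deg p) (hb : b ∈ B.deg q)
    (h : p + q = n) : (a ᵍ⊗ₜ[ℚ] b : A.deg ᵍ⊗[ℚ] B.deg) ∈ tensorDeg A B n :=
  h ▸ tmul_mem ha hb

theorem tensorD_tmul {p : ℤ} {a : A} (ha : a ∈ A.deg p) (b : B) :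
    tensorD A B (a ᵍ⊗ₜ[ℚ] b) = A.d a ᵍ⊗ₜ[ℚ] b + p.negOnePow • (a ᵍ⊗ₜ[ℚ] B.d b) := by
  have h : tensorD A B (a ᵍ⊗ₜ[ℚ] b) = A.d a ᵍ⊗ₜ[ℚ] b + A.sgn a ᵍ⊗ₜ[ℚ] B.d b := rfl
  rw [h, sgn_of_mem A ha]
  rw [units_smul_tmul]

theorem tmul_mul_tmul {q p' : ℤ} (a : A) {b : B} {a' : A} (b' : B) (hb : b ∈ B.deg q)
    (ha' : a' ∈ A.deg p') :
    (a ᵍ⊗ₜ[ℚ] b * a' ᵍ⊗ₜ[ℚ] b' : A.deg ᵍ⊗[ℚ] B.deg) =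
      (q * p').negOnePow • ((a * a') ᵍ⊗ₜ[ℚ] (b * b')) :=
  GradedTensorProduct.tmul_coe_mul_coe_tmul A.deg B.deg a ⟨b, hb⟩ ⟨a', ha'⟩ b'

/-- Homogeneous pure tensors span. -/
theorem tensor_induction {motive : (A.deg ᵍ⊗[ℚ] B.deg) → Prop}
    (tmul : ∀ (p q : ℤ) (a : A) (b : B), a ∈ A.deg p → b ∈ B.deg q → motive (a ᵍ⊗ₜ[ℚ] b))
    (zero : motive 0)
    (add : ∀ x y, motive x → motive y → motive (x + y)) (z : A.deg ᵍ⊗[ℚ] B.deg) : motive z := by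
  have key : ∀ (a : A) (b : B), motive (a ᵍ⊗ₜ[ℚ] b) := by
    intro a b
    induction a using DirectSum.Decomposition.inductionOn A.deg with
    | zero => exact (zero_tmul b).symm ▸ zero
    | add a a' h h' => exact (add_tmul a a' b).symm ▸ add _ _ h h'
    | @homogeneous p a =>
      induction b using DirectSum.Decomposition.inductionOn B.deg with
      | zero => exact (tmul_zero (B := B) (a : A)).symm ▸ zero
      | add b b' h h' => exact (tmul_add (a : A) b b').symm ▸ add _ _ h h'
      | @homogeneous q b => exact tmul p q a b a.2 b.2
  exact TensorProduct.induction_on (motive := fun x => motive (GradedTensorProduct.of ℚ _ _ x))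
    ((GradedTensorProduct.of ℚ A.deg B.deg).symm z) (by simpa using zero) key
    (fun x y hx hy => by simpa using add _ _ hx hy)

theorem tensorDeg_induction {n : ℤ} {motive : (A.deg ᵍ⊗[ℚ] B.deg) → Prop}
    (tmul : ∀ (p q : ℤ) (a : A) (b : B), a ∈ A.deg p → b ∈ B.deg q → p + q = n →
      motive (a ᵍ⊗ₜ[ℚ] b))
    (zero : motive 0)
    (add : ∀ x y, motive x → motive y → motive (x + y))
    {z : A.deg ᵍ⊗[ℚ] B.deg} (hz : z ∈ tensorDeg A B n) : motive z := by
  have key : ∀ c : ℚ, motive (c • z) := by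
    refine Submodule.span_induction (p := fun z _ => ∀ c : ℚ, motive (c • z)) ?_ ?_ ?_ ?_ hz
    · rintro _ ⟨p, q, a, b, ha, hb, h, rfl⟩ c
      rw [← smul_tmul]
      exact tmul p q _ b ((A.deg p).smul_mem c ha) hb h
    · intro c
      rw [smul_zero]
      exact zero
    · intro x y _ _ hx hy c
      rw [smul_add]
      exact add _ _ (hx c) (hy c)
    · intro e x _ hx c
      rw [smul_smul]
      exact hx _
  simpa using key 1

variable (A B) in
/-- Auxiliary: the decomposition of the tensor product into its homogeneous components. -/
noncomputable def tensorDecompose :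
    (A.deg ᵍ⊗[ℚ] B.deg) →ₗ[ℚ] ⨁ n, tensorDeg A B n :=
  TensorProduct.lift
    (LinearMap.compl₁₂
      (DirectSum.toModule ℚ ℤ ((⨁ q, B.deg q) →ₗ[ℚ] ⨁ n, tensorDeg A B n) fun p =>
        (DirectSum.toModule ℚ ℤ (A.deg p →ₗ[ℚ] ⨁ n, tensorDeg A B n) fun q =>
          LinearMap.mk₂ ℚ
            (fun (b : B.deg q) (a : A.deg p) =>
              DirectSum.lof ℚ ℤ (fun n => tensorDeg A B n) (p + q)
                ⟨(a : A) ᵍ⊗ₜ[ℚ] (b : B), tmul_mem a.2 b.2⟩)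
            (fun b b' a => by
              rw [← map_add]; congr 1; ext1; exact tmul_add _ _ _)
            (fun c b a => by
              rw [← map_smul]; congr 1; ext1; exact TensorProduct.tmul_smul _ _ _)
            (fun b a a' => by
              rw [← map_add]; congr 1; ext1; exact add_tmul _ _ _)
            (fun c b a => by
              rw [← map_smul]; congr 1)).flip)
      (DirectSum.decomposeLinearEquiv A.deg).toLinearMap
      (DirectSum.decomposeLinearEquiv B.deg).toLinearMap) ∘ₗ
    (GradedTensorProduct.of ℚ A.deg B.deg).symm.toLinearMap

theorem tensorDecompose_tmul {p q n : ℤ} {a : A} {b : B} (ha : a ∈ A.deg p) (hb : b ∈ B.deg q)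
    (h : p + q = n) :
    tensorDecompose A B (a ᵍ⊗ₜ[ℚ] b) =
      DirectSum.lof ℚ ℤ (fun n => tensorDeg A B n) n ⟨a ᵍ⊗ₜ[ℚ] b, tmul_mem' ha hb h⟩ := by
  subst h
  lift a to A.deg p using ha
  lift b to B.deg q using hb
  simp [tensorDecompose]

noncomputable instance tensorDecomposition : DirectSum.Decomposition (tensorDeg A B) :=
  DirectSum.Decomposition.ofLinearMap (tensorDeg A B) (tensorDecompose A B)
    (by
      refine LinearMap.ext fun z => ?_
      refine tensor_induction (motive := fun z =>
        ((DirectSum.coeLinearMap (tensorDeg A B)) ∘ₗ (tensorDecompose A B)) z = LinearMap.id z)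
        ?_ ?_ ?_ z
      · intro p q a b ha hb
        rw [LinearMap.comp_apply, tensorDecompose_tmul ha hb rfl, DirectSum.coeLinearMap_lof]
        rfl
      · simp
      · intro x y hx hy
        rw [map_add, hx, hy, map_add])
    (by
      refine DirectSum.linearMap_ext ℚ fun n => LinearMap.ext fun ⟨z, hz⟩ => ?_
      simp only [LinearMap.comp_apply, DirectSum.coeLinearMap_lof, LinearMap.id_apply]
      suffices H : ∃ h : z ∈ tensorDeg A B n,
          tensorDecompose A B z = DirectSum.lof ℚ ℤ (fun n => tensorDeg A B n) n ⟨z, h⟩ from H.2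
      refine tensorDeg_induction (motive := fun z => ∃ h : z ∈ tensorDeg A B n,
          tensorDecompose A B z = DirectSum.lof ℚ ℤ (fun n => tensorDeg A B n) n ⟨z, h⟩)
          ?_ ?_ ?_ hz
      · intro p q a b ha hb h
        exact ⟨_, tensorDecompose_tmul ha hb h⟩
      · exact ⟨Submodule.zero_mem _, by rw [map_zero]; exact (map_zero _).symm⟩
      · rintro x y ⟨hx, ex⟩ ⟨hy, ey⟩
        refine ⟨Submodule.add_mem _ hx hy, ?_⟩
        rw [map_add, ex, ey, ← map_add]
        rfl)

theorem units_smul_mem {X : Type u} [AddCommGroup X] [Module ℚ X] (N : Submodule ℚ X) (c : ℤˣ)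
    {x : X} (hx : x ∈ N) : c • x ∈ N := by
  rcases Int.units_eq_one_or c with e | e <;> simpa [e] using hx

theorem map_units_smul {X : Type u} {Y : Type v} [AddCommGroup X] [Module ℚ X]
    [AddCommGroup Y] [Module ℚ Y] (f : X →ₗ[ℚ] Y) (c : ℤˣ) (x : X) : f (c • x) = c • f x := by
  rcases Int.units_eq_one_or c with e | e <;> simp [e]

theorem units_smul_mul {X : Type u} [Ring X] (c : ℤˣ) (x y : X) : (c • x) * y = c • (x * y) := by
  rcases Int.units_eq_one_or c with e | e <;> simp [e]

theorem mul_units_smul {X : Type u} [Ring X] (c : ℤˣ) (x y : X) : x * (c • y) = c • (x * y) := by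
  rcases Int.units_eq_one_or c with e | e <;> simp [e]

theorem negOnePow_congr {p q : ℤ} (k : ℤ) (h : p - q = k + k) : p.negOnePow = q.negOnePow :=
  (Int.negOnePow_eq_iff p q).2 ⟨k, h⟩

noncomputable instance tensorGraded : GradedAlgebra (tensorDeg A B) where
  toDecomposition := tensorDecomposition
  one_mem := by
    have h : (1 : A.deg ᵍ⊗[ℚ] B.deg) = (1 : A) ᵍ⊗ₜ[ℚ] (1 : B) := rfl
    rw [h]
    exact tmul_mem' (SetLike.GradedOne.one_mem) (SetLike.GradedOne.one_mem) (add_zero 0)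
  mul_mem := by
    intro m n x y hx hy
    refine tensorDeg_induction (motive := fun x => x * y ∈ tensorDeg A B (m + n)) ?_ ?_ ?_ hx
    · intro p q a b ha hb h
      refine tensorDeg_induction
        (motive := fun y => a ᵍ⊗ₜ[ℚ] b * y ∈ tensorDeg A B (m + n)) ?_ ?_ ?_ hy
      · intro p' q' a' b' ha' hb' h'
        rw [tmul_mul_tmul a b' hb ha']
        exact units_smul_mem _ _ (tmul_mem' (SetLike.GradedMul.mul_mem ha ha')
          (SetLike.GradedMul.mul_mem hb hb') (by omega))
      · simp
      · intro y y' h h'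
        rw [mul_add]
        exact Submodule.add_mem _ h h'
    · simp
    · intro x x' h h'
      rw [add_mul]
      exact Submodule.add_mem _ h h'

/-- The tensor product `(A, d) ⊗ (B, d)`, with product
`(a ⊗ b) (a' ⊗ b') = (-1)^{|b| |a'|} a a' ⊗ b b'`. -/
noncomputable def tensor (A : CDGA.{u}) (B : CDGA.{v}) : CDGA.{max u v} where
  carrier := A.deg ᵍ⊗[ℚ] B.deg
  deg := tensorDeg A B
  d := tensorD A B
  d_mem := by
    intro n x hx
    refine tensorDeg_induction (motive := fun x => tensorD A B x ∈ tensorDeg A B (n + 1))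
      ?_ ?_ ?_ hx
    · intro p q a b ha hb h
      rw [tensorD_tmul ha]
      exact Submodule.add_mem _ (tmul_mem' (A.d_mem ha) hb (by omega))
        (units_smul_mem _ _ (tmul_mem' ha (B.d_mem hb) (by omega)))
    · simp
    · intro x y h h'
      rw [map_add]
      exact Submodule.add_mem _ h h'
  d_d := by
    refine tensor_induction ?_ ?_ ?_
    · intro p q a b ha hb
      rw [tensorD_tmul ha, map_add, map_units_smul, tensorD_tmul (A.d_mem ha), tensorD_tmul ha,
        A.d_d, B.d_d, zero_tmul, tmul_zero, Int.negOnePow_succ]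
      simp
    · simp
    · intro x y h h'
      rw [map_add, map_add, h, h', add_zero]
  leibniz := by
    intro n x hx y
    refine tensorDeg_induction (motive := fun x =>
      tensorD A B (x * y) = tensorD A B x * y + n.negOnePow • (x * tensorD A B y)) ?_ ?_ ?_ hx
    · intro p q a b ha hb h
      refine tensor_induction (motive := fun y =>
        tensorD A B (a ᵍ⊗ₜ[ℚ] b * y) = tensorD A B (a ᵍ⊗ₜ[ℚ] b) * y +
          n.negOnePow • (a ᵍ⊗ₜ[ℚ] b * tensorD A B y)) ?_ ?_ ?_ y
      · intro p' q' a' b' ha' hb'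
        rw [tmul_mul_tmul a b' hb ha', map_units_smul,
          tensorD_tmul (SetLike.GradedMul.mul_mem ha ha'), tensorD_tmul ha, tensorD_tmul ha',
          A.leibniz ha, B.leibniz hb, add_mul, mul_add, units_smul_mul, mul_units_smul,
          tmul_mul_tmul _ b' hb ha', tmul_mul_tmul _ b' (B.d_mem hb) ha',
          tmul_mul_tmul a b' hb (A.d_mem ha'), tmul_mul_tmul a (B.d b') hb ha',
          add_tmul, tmul_add, units_smul_tmul, tmul_units_smul, ← h]
        simp only [smul_add, smul_smul, ← Int.negOnePow_add]
        rw [negOnePow_congr (p := q * p' + (p + p')) (q := p + (q + 1) * p') 0 (by ring),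
          negOnePow_congr (p := q * p' + (p + p' + q)) (q := p + q + (p' + q * p')) 0 (by ring),
          negOnePow_congr (p := p + q + q * (p' + 1)) (q := q * p' + p) q (by ring)]
        abel
      · simp
      · intro y y' h h'
        rw [mul_add, map_add, map_add, h, h', mul_add, mul_add, smul_add]
        abel
    · simp
    · intro x x' h h'
      rw [add_mul, map_add, map_add, h, h', add_mul, add_mul, smul_add]
      abel
  comm := by
    intro m n x y hx hy
    refine tensorDeg_induction (motive := fun x => x * y = (m * n).negOnePow • (y * x)) ?_ ?_ ?_ hx
    · intro p q a b ha hb h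
      refine tensorDeg_induction (motive := fun y =>
        a ᵍ⊗ₜ[ℚ] b * y = (m * n).negOnePow • (y * a ᵍ⊗ₜ[ℚ] b)) ?_ ?_ ?_ hy
      · intro p' q' a' b' ha' hb' h'
        rw [tmul_mul_tmul a b' hb ha', tmul_mul_tmul a' b hb' ha, A.comm ha ha', B.comm hb hb',
          units_smul_tmul, tmul_units_smul, ← h, ← h']
        simp only [smul_smul, ← Int.negOnePow_add]
        congr 1
        exact negOnePow_congr (-(p * q')) (by ring)
      · simp
      · intro y y' h h'
        rw [mul_add, h, h', add_mul, smul_add]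
    · simp
    · intro x x' h h'
      rw [add_mul, h, h', mul_add, smul_add]

/-- The multiplication `μ : (A, d) ⊗ (A, d) → (A, d)`, `a ⊗ b ↦ a b`. -/
noncomputable def mul (A : CDGA.{u}) : (A.tensor A).Hom A where
  toAlgHom := GradedTensorProduct.lift A.deg A.deg (AlgHom.id ℚ A) (AlgHom.id ℚ A)
    (fun i j a b => by
      rw [mul_comm j i]
      exact A.comm a.2 b.2)
  map_deg := by
    intro n x hx
    refine tensorDeg_induction (motive := fun x =>
      GradedTensorProduct.lift A.deg A.deg (AlgHom.id ℚ A) (AlgHom.id ℚ A) _ x ∈ A.deg n)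
      ?_ ?_ ?_ hx
    · rintro p q a b ha hb rfl
      exact SetLike.GradedMul.mul_mem ha hb
    · simp
    · intro x y h h'
      rw [map_add]
      exact Submodule.add_mem _ h h'
  map_d := by
    refine tensor_induction (motive := fun x =>
      GradedTensorProduct.lift A.deg A.deg (AlgHom.id ℚ A) (AlgHom.id ℚ A) _ (tensorD A A x) =
        A.d (GradedTensorProduct.lift A.deg A.deg (AlgHom.id ℚ A) (AlgHom.id ℚ A) _ x)) ?_ ?_ ?_
    · intro p q a b ha hb
      rw [tensorD_tmul ha, map_add, ← AlgHom.toLinearMap_apply, ← AlgHom.toLinearMap_apply,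
        map_units_smul]
      exact (A.leibniz ha b).symm
    · simp
    · intro x y h h'
      rw [map_add, map_add, h, h', map_add, map_add]

end CDGA

/-! ### Free graded commutative algebras and (relative) Sullivan algebras -/

/-- The relations `v w = (-1)^{|v||w|} w v` in the tensor algebra on a graded vector space. -/
inductive FreeGCA.Rel {X : Type u} [AddCommGroup X] [Module ℚ X] (V : ℤ → Submodule ℚ X) :
    TensorAlgebra ℚ (⨁ n, V n) → TensorAlgebra ℚ (⨁ n, V n) → Prop
  | comm (p q : ℤ) (x : V p) (y : V q) : FreeGCA.Rel V
      (TensorAlgebra.ι ℚ (DirectSum.lof ℚ ℤ (fun n => V n) p x) *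
        TensorAlgebra.ι ℚ (DirectSum.lof ℚ ℤ (fun n => V n) q y))
      ((p * q).negOnePow •
        (TensorAlgebra.ι ℚ (DirectSum.lof ℚ ℤ (fun n => V n) q y) *
          TensorAlgebra.ι ℚ (DirectSum.lof ℚ ℤ (fun n => V n) p x)))

/-- The free graded commutative algebra `∧V` on the graded vector space `V = ⨁ V^n`. -/
abbrev FreeGCA {X : Type u} [AddCommGroup X] [Module ℚ X] (V : ℤ → Submodule ℚ X) : Type u :=
  RingQuot (FreeGCA.Rel V)

namespace CDGA

/-- For graded subspaces `V^n ⊆ A^n` of a commutative differential graded algebra, the canonical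
morphism of algebras `∧V → A` which is the inclusion on `V`. -/
noncomputable def freeLift (A : CDGA.{u}) (V : ℤ → Submodule ℚ A) (hV : ∀ n, V n ≤ A.deg n) :
    FreeGCA V →ₐ[ℚ] A :=
  RingQuot.liftAlgHom ℚ
    ⟨TensorAlgebra.lift ℚ (DirectSum.toModule ℚ ℤ A fun n => (V n).subtype), by
      rintro _ _ ⟨p, q, x, y⟩
      refine Eq.trans ?_ (map_units_smul (TensorAlgebra.lift ℚ
        (DirectSum.toModule ℚ ℤ A.carrier fun n => (V n).subtype)).toLinearMap _ _).symm
      simpa using A.comm (hV p x.2) (hV q y.2)⟩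

/-- `(A, d) = (∧V, d)` is a Sullivan (free) model with `V = V^{≥ 2}` of finite type: as a graded
algebra, `A` is free graded commutative on the graded subspace `V`. (For `V = V^{≥ 2}` the
nilpotence condition on `d` holds automatically.) -/
structure IsSullivanModel (A : CDGA.{u}) (V : ℤ → Submodule ℚ A) : Prop where
  le_deg : ∀ n, V n ≤ A.deg n
  eq_bot : ∀ n < 2, V n = ⊥
  finite : ∀ n, FiniteDimensional ℚ (V n)
  bijective : Function.Bijective (A.freeLift V le_deg)

/-- `i : (R, d) → (P, D)` is a relative Sullivan algebra with fibre generators `W = W^{≥ 1}`: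
as a graded algebra `P = R ⊗ ∧W`, with `i` the inclusion of `R`, and `W` is the union of graded
subspaces `F 0 ⊆ F 1 ⊆ ⋯` with `D (F 0) ⊆ R` and `D (F (k+1)) ⊆ R ⊗ ∧(F k)`. -/
structure IsRelativeSullivan {R : CDGA.{u}} {P : CDGA.{v}} (i : R.Hom P)
    (W : ℤ → Submodule ℚ P) : Prop where
  le_deg : ∀ n, W n ≤ P.deg n
  eq_bot : ∀ n < 1, W n = ⊥
  bijective : Function.Bijective (TensorProduct.lift
    ((LinearMap.mul ℚ P).compl₁₂ i.toLinearMap (P.freeLift W le_deg).toLinearMap))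
  nilpotent : ∃ F : ℕ → ℤ → Submodule ℚ P, Monotone F ∧ (∀ n, ⨆ k, F k n = W n) ∧
    (∀ n, ∀ x ∈ F 0 n, P.d x ∈ Set.range i) ∧
    (∀ k n, ∀ x ∈ F (k + 1) n, P.d x ∈ Algebra.adjoin ℚ (Set.range i ∪ ⋃ j, (F k j : Set P)))

/-- `(P, D) = (∧V ⊗ ∧V' ⊗ ∧W, D)`, with structure maps `i` and `φ`, is a relative Sullivan model of
the multiplication `μ : A ⊗ A → A`, where `A = ∧V` and `V'` is a copy of `V`: `i` is a relative
Sullivan algebra, `φ` is a quasi-isomorphism, and `φ ∘ i = μ`. -/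
structure IsMulModel {A : CDGA.{u}} {P : CDGA.{v}} (i : (A.tensor A).Hom P)
    (W : ℤ → Submodule ℚ P) (φ : P.Hom A) : Prop where
  relative : IsRelativeSullivan i W
  quasiIso : IsQuasiIso P.d A.d φ
  comm : ∀ z, φ (i z) = A.mul z

/-! ### Poincaré duality and the diagonal class -/

/-- `u` is a cycle of degree `m` in `Hom(A, ℚ)` (a fundamental class) such that `H(A)` is a Poincaré
duality algebra of formal dimension `m`: it is finite dimensional and the pairing
`([x], [y]) ↦ u (x y)` on it is nondegenerate. -/
structure IsPoincareDuality (A : CDGA.{u}) (m : ℕ) (u : A →ₗ[ℚ] ℚ) : Prop where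
  homogeneous : ∀ n : ℤ, n ≠ m → ∀ x ∈ A.deg n, u x = 0
  cycle : ∀ x, u (A.d x) = 0
  finite : FiniteDimensional ℚ A.Cohomology
  nondegenerate : ∀ x, A.d x = 0 → (∀ y, A.d y = 0 → u (x * y) = 0) → x ∈ LinearMap.range A.d

/-- Homogeneous cocycles `a j` whose classes form a basis of `H(A)`, and homogeneous cocycles `b j`
whose classes form the Poincaré dual basis: `⟨a j * b k, u⟩ = δ_{jk}`. -/
structure DualBases (A : CDGA.{u}) (m : ℕ) (u : A →ₗ[ℚ] ℚ) (J : Type w) where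
  a : J → A
  b : J → A
  /-- the degree of `a j` -/
  p : J → ℤ
  a_mem : ∀ j, a j ∈ A.deg (p j)
  b_mem : ∀ j, b j ∈ A.deg (m - p j)
  d_a : ∀ j, A.d (a j) = 0
  d_b : ∀ j, A.d (b j) = 0
  linearIndependent : LinearIndependent ℚ fun j => A.cls (a j) (d_a j)
  span_eq_top : Submodule.span ℚ (Set.range fun j => A.cls (a j) (d_a j)) = ⊤
  pairing_self : ∀ j, u (a j * b j) = 1
  pairing_ne : ∀ j k, j ≠ k → u (a j * b k) = 0

/-- The cocycle `T = ∑ (-1)^{|a j|} a j ⊗ b j` of degree `m`, representing the diagonal class. -/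
noncomputable def DualBases.T {A : CDGA.{u}} {m : ℕ} {u : A →ₗ[ℚ] ℚ} {J : Type w} [Fintype J]
    (E : DualBases A m u J) : A.tensor A :=
  ∑ j, (E.p j).negOnePow • (E.a j ᵍ⊗ₜ[ℚ] E.b j : A.deg ᵍ⊗[ℚ] A.deg)

end CDGA

/-! ### Differential graded modules, the complex `Hom_R(M, N)`, semifree resolutions -/

/-- A (left) differential graded module over `R`. -/
structure DGModule (R : CDGA.{u}) where
  carrier : Type v
  [addCommGroup : AddCommGroup carrier]
  [moduleRat : Module ℚ carrier]
  [module : Module R carrier]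
  [tower : IsScalarTower ℚ R carrier]
  /-- the homogeneous components -/
  deg : ℤ → Submodule ℚ carrier
  [decomposition : DirectSum.Decomposition deg]
  smul_mem : ∀ {p q : ℤ} {r : R} {x : carrier}, r ∈ R.deg p → x ∈ deg q → r • x ∈ deg (p + q)
  /-- the differential -/
  d : carrier →ₗ[ℚ] carrier
  d_mem : ∀ {n : ℤ} {x : carrier}, x ∈ deg n → d x ∈ deg (n + 1)
  d_d : ∀ x : carrier, d (d x) = 0
  leibniz : ∀ {p : ℤ} {r : R}, r ∈ R.deg p → ∀ x : carrier,
    d (r • x) = R.d r • x + p.negOnePow • (r • d x)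

instance (R : CDGA.{u}) : CoeSort (DGModule.{u, v} R) (Type v) := ⟨DGModule.carrier⟩

attribute [instance] DGModule.addCommGroup DGModule.moduleRat DGModule.module DGModule.tower
  DGModule.decomposition

/-- A commutative differential graded algebra `B` as a module over `R`, through `f : R → B`. -/
def CDGA.Hom.dgModule {R : CDGA.{u}} {B : CDGA.{v}} (f : R.Hom B) : DGModule.{u, v} R :=
  letI : Module R B := Module.compHom B f.toAlgHom.toRingHom
  { carrier := B
    tower := ⟨fun c r x => by
      change f (c • r) * x = c • (f r * x)
      rw [map_smul, smul_mul_assoc]⟩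
    deg := B.deg
    smul_mem := fun hr hx => SetLike.GradedMul.mul_mem (f.map_deg hr) hx
    d := B.d
    d_mem := B.d_mem
    d_d := B.d_d
    leibniz := fun {p r} hr x => by
      change B.d (f r * x) = f (R.d r) * x + p.negOnePow • (f r * B.d x)
      have h : f (R.d r) = B.d (f r) := f.map_d r
      rw [h]
      exact B.leibniz (f.map_deg hr) x }

/-- `R` as a differential graded module over itself. -/
def CDGA.self (R : CDGA.{u}) : DGModule.{u, u} R := (CDGA.Hom.id R).dgModule

/-- For `i : R → P` and a cocycle `T` of `R`: the restriction of `f : P → R` to `R` induces the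
multiplication by `T` in cohomology, `[f (i z)] = [T] [z]` for all cocycles `z`. -/
def CDGA.Hom.RestrictsToMul {R : CDGA.{u}} {P : CDGA.{v}} (i : R.Hom P) (T : R)
    (f : i.dgModule →ₗ[ℚ] R.self) : Prop :=
  ∀ z : R, R.d z = 0 → (show R from f (show i.dgModule from i z)) - T * z ∈ LinearMap.range R.d

namespace DGModule

variable {R : CDGA.{u}} (M : DGModule.{u, v} R) (N : DGModule.{u, w} R)

/-- `Hom_R^k(M, N)`: the linear maps `f` of degree `k` with
`f (r x) = (-1)^{k |r|} r f(x)`. -/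
def homDeg (k : ℤ) : Submodule ℚ (M →ₗ[ℚ] N) where
  carrier := {f | (∀ n, ∀ x ∈ M.deg n, f x ∈ N.deg (n + k)) ∧
    ∀ p, ∀ r ∈ R.deg p, ∀ x, f (r • x) = (k * p).negOnePow • (r • f x)}
  add_mem' := by
    rintro f g ⟨hf, hf'⟩ ⟨hg, hg'⟩
    refine ⟨fun n x hx => Submodule.add_mem _ (hf n x hx) (hg n x hx), fun p r hr x => ?_⟩
    rw [LinearMap.add_apply, LinearMap.add_apply, hf' p r hr, hg' p r hr, smul_add, smul_add]
  zero_mem' := ⟨fun n x _ => Submodule.zero_mem _, fun p r _ x => by simp⟩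
  smul_mem' := by
    rintro c f ⟨hf, hf'⟩
    refine ⟨fun n x hx => Submodule.smul_mem _ c (hf n x hx), fun p r hr x => ?_⟩
    have h : r • (c • f x) = c • (r • f x) := smul_algebra_smul_comm c r (f x)
    rw [LinearMap.smul_apply, LinearMap.smul_apply, hf' p r hr, h]
    rcases Int.units_eq_one_or (k * p).negOnePow with e | e <;> simp [e]

/-- The differential `f ↦ d f - (-1)^k f d` on maps of degree `k`. -/
def homD (k : ℤ) : (M →ₗ[ℚ] N) →ₗ[ℚ] (M →ₗ[ℚ] N) where
  toFun f := N.d ∘ₗ f - k.negOnePow • (f ∘ₗ M.d)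
  map_add' f g := by
    rw [LinearMap.comp_add, LinearMap.add_comp, smul_add]
    abel
  map_smul' c f := by
    rcases Int.units_eq_one_or k.negOnePow with e | e <;>
      simp [e, LinearMap.comp_smul, LinearMap.smul_comp, smul_sub]

/-- The morphisms of differential graded `R`-modules `M → N` of degree `k`: the cocycles of degree
`k` in `Hom_R(M, N)`. -/
def morphisms (k : ℤ) : Submodule ℚ (M →ₗ[ℚ] N) :=
  M.homDeg N k ⊓ LinearMap.ker (M.homD N k)

/-- The coboundaries of degree `k` in `Hom_R(M, N)`: the morphisms which are homotopic to zero. -/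
def coboundaries (k : ℤ) : Submodule ℚ (M →ₗ[ℚ] N) :=
  (M.homDeg N (k - 1)).map (M.homD N (k - 1))

/-- `H^k(Hom_R(M, N))`: homotopy classes of morphisms of degree `k`. -/
abbrev homCohomology (k : ℤ) : Type (max v w) :=
  M.morphisms N k ⧸ (M.coboundaries N k).submoduleOf (M.morphisms N k)

variable {M N} in
/-- `f` and `g`, of degree `k`, are homotopic: `f - g = d h - (-1)^{k-1} h d` for some `R`-linear map
`h` of degree `k - 1`. -/
def Homotopic (k : ℤ) (f g : M →ₗ[ℚ] N) : Prop :=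
  ∃ h ∈ M.homDeg N (k - 1), f - g = M.homD N (k - 1) h

/-- `M` is semifree: it has a homogeneous `R`-basis, filtered by levels in `ℕ`, such that the
differential of a basis element is an `R`-combination of basis elements of smaller level. -/
def IsSemifree : Prop :=
  ∃ (J : Type v) (e : Module.Basis J R M) (level : J → ℕ),
    (∀ j, ∃ n, e j ∈ M.deg n) ∧
    ∀ j, M.d (e j) ∈ Submodule.span R (e '' {j' | level j' < level j})

variable {M N} in
/-- `ψ : M → N` is a semifree resolution of the differential graded `R`-module `N`. -/
def IsSemifreeResolution (ψ : M →ₗ[ℚ] N) : Prop :=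
  M.IsSemifree ∧ ψ ∈ M.morphisms N 0 ∧ IsQuasiIso M.d N.d ψ

end DGModule

/-! The algebra `R = A ⊗ A` satisfies Poincaré duality in dimension `2m`, with functional `U = u ⊗
u`. Hence the duality map `c ↦ U(- * c)` from `R` to its dual `R^#` is a quasi-isomorphism up to a
shift. For a semifree `R`-module `Q` this gives `H^k(Hom_R(Q, R)) ≅ H^{2m-k}(Q)^#`, where the class
of `f` goes to the functional `U ∘ f` on cocycles. If `Q` resolves `A` and `k = m`, the right side
is the dual of `H^m(A)`, which is a line because `A^0 = ℚ`.

Surjectivity of this correspondence is `IsSemifree.exists_morphism`, injectivity is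
`IsSemifree.mem_coboundaries`. Both come from `IsSemifree.exists_homotopy` (maps from a semifree
module to an acyclic complex are null-homotopic), applied to the cone of the duality map. The cone
is acyclic (`cone_acyclic`) because `R` contracts explicitly onto its cohomology, by the tensor
product of two contractions of `A`.

The relative Sullivan model `P` is itself a semifree resolution (`IsRelativeSullivan.isSemifree`). A
morphism `f : P → R` of degree `m` satisfies `f (i z) = ± z f(1) = f(1) z`, so the condition on its
restriction to `R` says `[f(1)] = [T]`. For existence, `f` is chosen with `U ∘ f = (-1)^m u ∘ φ` on
cocycles, and pairing with the `b j ⊗ b k` identifies `[f(1)]` with `[T]`. For uniqueness, if `f(1)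
- g(1)` is exact then `U ∘ (f - g)` vanishes at a cocycle over the fundamental class, and this one
number detects the homotopy class. -/

section GradedMaps

/-! ### Graded linear maps and homogeneous projections. -/

variable {X : Type*} [AddCommGroup X] [Module ℚ X] (ℳ : ℤ → Submodule ℚ X)
  [DirectSum.Decomposition ℳ] {Y : Type*} [AddCommGroup Y] [Module ℚ Y]

/-- The linear map which is `F n` on the component of degree `n`. -/
noncomputable def gradedMap (F : ℤ → X →ₗ[ℚ] Y) : X →ₗ[ℚ] Y :=
  DirectSum.toModule ℚ ℤ Y (fun n => F n ∘ₗ (ℳ n).subtype) ∘ₗ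
    (DirectSum.decomposeLinearEquiv ℳ).toLinearMap

theorem gradedMap_of_mem (F : ℤ → X →ₗ[ℚ] Y) {n : ℤ} {x : X} (hx : x ∈ ℳ n) :
    gradedMap ℳ F x = F n x := by
  lift x to ℳ n using hx
  simp [gradedMap]

/-- The projection on the component of degree `n`. -/
noncomputable def gradedProj (n : ℤ) : X →ₗ[ℚ] X :=
  gradedMap ℳ fun k => if k = n then LinearMap.id else 0

theorem gradedProj_of_mem {n : ℤ} {x : X} (hx : x ∈ ℳ n) : gradedProj ℳ n x = x := by
  simp [gradedProj, gradedMap_of_mem ℳ _ hx]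

theorem gradedProj_of_mem_ne {n k : ℤ} {x : X} (hx : x ∈ ℳ k) (h : k ≠ n) :
    gradedProj ℳ n x = 0 := by
  simp [gradedProj, gradedMap_of_mem ℳ _ hx, h]

theorem graded_induction {motive : X → Prop} (zero : motive 0)
    (add : ∀ x y, motive x → motive y → motive (x + y))
    (mem : ∀ n, ∀ x ∈ ℳ n, motive x) (x : X) : motive x :=
  DirectSum.Decomposition.inductionOn ℳ zero (fun {n} y => mem n y y.2) add x

theorem gradedProj_mem (n : ℤ) (x : X) : gradedProj ℳ n x ∈ ℳ n := by
  refine graded_induction ℳ (motive := fun x => gradedProj ℳ n x ∈ ℳ n) (by simp)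
    (fun x y hx hy => by rw [map_add]; exact add_mem hx hy) (fun k x hx => ?_) x
  by_cases h : k = n
  · subst h
    rwa [gradedProj_of_mem ℳ hx]
  · rw [gradedProj_of_mem_ne ℳ hx h]
    exact zero_mem _

/-- A statement closed under addition holds for `x` if it holds for its homogeneous components. -/
theorem induction_of_gradedProj {motive : X → Prop} (zero : motive 0)
    (add : ∀ x y, motive x → motive y → motive (x + y)) (x : X)
    (h : ∀ n, motive (gradedProj ℳ n x)) : motive x := by
  have e : ∀ n, gradedProj ℳ n x = DirectSum.decompose ℳ x n := by
    intro n
    refine graded_induction ℳ (motive := fun x => gradedProj ℳ n x = DirectSum.decompose ℳ x n)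
      (by simp) (fun x y hx hy => by simp [hx, hy]) (fun k x hx => ?_) x
    by_cases hk : k = n
    · subst hk
      rw [gradedProj_of_mem ℳ hx, DirectSum.decompose_of_mem_same ℳ hx]
    · rw [gradedProj_of_mem_ne ℳ hx hk, DirectSum.decompose_of_mem_ne ℳ hx hk]
  classical
  rw [← DirectSum.sum_support_decompose ℳ x]
  refine Finset.sum_induction _ motive add zero fun n _ => ?_
  rw [← e]
  exact h n

variable {ℳ} in
theorem linearMap_ext_graded {f g : X →ₗ[ℚ] Y} (h : ∀ n, ∀ x ∈ ℳ n, f x = g x) (x : X) :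
    f x = g x :=
  graded_induction ℳ (motive := fun x => f x = g x) (by simp)
    (fun x y hx hy => by simp [hx, hy]) h x

/-- Homogeneous maps commute with projections. -/
theorem map_gradedProj (𝒩 : ℤ → Submodule ℚ Y) [DirectSum.Decomposition 𝒩] (k : ℤ)
    (f : X →ₗ[ℚ] Y) (hf : ∀ n, ∀ x ∈ ℳ n, f x ∈ 𝒩 (n + k)) (n : ℤ) (x : X) :
    f (gradedProj ℳ n x) = gradedProj 𝒩 (n + k) (f x) := by
  refine linearMap_ext_graded (ℳ := ℳ) (f := f ∘ₗ gradedProj ℳ n)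
    (g := gradedProj 𝒩 (n + k) ∘ₗ f) (fun j x hx => ?_) x
  by_cases h : j = n
  · subst h
    simp [gradedProj_of_mem ℳ hx, gradedProj_of_mem 𝒩 (hf _ _ hx)]
  · simp [gradedProj_of_mem_ne ℳ hx h, gradedProj_of_mem_ne 𝒩 (hf _ _ hx)
      (show j + k ≠ n + k by omega)]

end GradedMaps

/-! ### Sign twists, and Leibniz rules without homogeneity assumptions. -/

namespace CDGA

variable (A : CDGA.{u})

/-- The map `x ↦ (-1)^{k |x|} x`. -/
noncomputable def twist (k : ℤ) : A →ₗ[ℚ] A :=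
  gradedMap A.deg fun n => (k * n).negOnePow • LinearMap.id

variable {A}

theorem twist_of_mem (k : ℤ) {n : ℤ} {x : A} (hx : x ∈ A.deg n) :
    A.twist k x = (k * n).negOnePow • x := by
  simp [twist, gradedMap_of_mem A.deg _ hx]

theorem twist_mem (k : ℤ) {n : ℤ} {x : A} (hx : x ∈ A.deg n) : A.twist k x ∈ A.deg n := by
  rw [twist_of_mem k hx]
  exact units_smul_mem _ _ hx

theorem sgn_mem {n : ℤ} {x : A} (hx : x ∈ A.deg n) : A.sgn x ∈ A.deg n := by
  rw [sgn_of_mem A hx]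
  exact units_smul_mem _ _ hx

theorem units_smul_cancel {X : Type*} [AddCommGroup X] (c : ℤˣ) (x : X) : c • c • x = x := by
  rw [smul_smul, Int.units_mul_self, one_smul]

theorem twist_twist (k : ℤ) (x : A) : A.twist k (A.twist k x) = x := by
  refine linearMap_ext_graded (ℳ := A.deg) (f := A.twist k ∘ₗ A.twist k) (g := LinearMap.id)
    (fun n x hx => ?_) x
  simp [twist_of_mem k hx, units_smul_cancel]

theorem sgn_sgn (x : A) : A.sgn (A.sgn x) = x := by
  refine linearMap_ext_graded (ℳ := A.deg) (f := A.sgn ∘ₗ A.sgn) (g := LinearMap.id)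
    (fun n x hx => ?_) x
  simp [sgn_of_mem A hx, units_smul_cancel]

theorem sgn_twist (k : ℤ) (x : A) : A.sgn (A.twist k x) = A.twist (k + 1) x := by
  refine linearMap_ext_graded (ℳ := A.deg) (f := A.sgn ∘ₗ A.twist k) (g := A.twist (k + 1))
    (fun n x hx => ?_) x
  rw [LinearMap.comp_apply, twist_of_mem k hx, map_units_smul, sgn_of_mem A hx,
    twist_of_mem _ hx, smul_smul, ← Int.negOnePow_add, add_mul, one_mul]

theorem twist_sgn (k : ℤ) (x : A) : A.twist k (A.sgn x) = A.twist (k + 1) x := by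
  refine linearMap_ext_graded (ℳ := A.deg) (f := A.twist k ∘ₗ A.sgn) (g := A.twist (k + 1))
    (fun n x hx => ?_) x
  rw [LinearMap.comp_apply, sgn_of_mem A hx, map_units_smul, twist_of_mem k hx,
    twist_of_mem _ hx, smul_smul, ← Int.negOnePow_add, add_mul, one_mul, add_comm]

theorem twist_succ_sgn (k : ℤ) (x : A) : A.twist (k + 1) (A.sgn x) = A.twist k x := by
  rw [← sgn_twist, twist_sgn, ← sgn_twist, sgn_sgn]

theorem sgn_twist_succ (k : ℤ) (x : A) : A.sgn (A.twist (k + 1) x) = A.twist k x := by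
  rw [← sgn_twist, sgn_sgn]

theorem d_twist (k : ℤ) (x : A) : A.d (A.twist k x) = k.negOnePow • A.twist k (A.d x) := by
  refine linearMap_ext_graded (ℳ := A.deg) (f := A.d ∘ₗ A.twist k)
    (g := k.negOnePow • (A.twist k ∘ₗ A.d)) (fun n x hx => ?_) x
  rw [LinearMap.comp_apply, LinearMap.smul_apply, LinearMap.comp_apply, twist_of_mem k hx,
    map_units_smul, twist_of_mem k (A.d_mem hx), smul_smul, ← Int.negOnePow_add]
  congr 1
  exact negOnePow_congr (-k) (by ring)

theorem d_sgn (x : A) : A.d (A.sgn x) = -A.sgn (A.d x) := by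
  refine linearMap_ext_graded (ℳ := A.deg) (f := A.d ∘ₗ A.sgn)
    (g := -(A.sgn ∘ₗ A.d)) (fun n x hx => ?_) x
  simp [sgn_of_mem A hx, sgn_of_mem A (A.d_mem hx), Int.negOnePow_succ]

theorem twist_mul (k : ℤ) (x y : A) : A.twist k (x * y) = A.twist k x * A.twist k y := by
  refine linearMap_ext_graded (ℳ := A.deg) (f := A.twist k ∘ₗ LinearMap.mulRight ℚ y)
    (g := LinearMap.mulRight ℚ (A.twist k y) ∘ₗ A.twist k) (fun n x hx => ?_) x
  refine linearMap_ext_graded (ℳ := A.deg) (f := A.twist k ∘ₗ LinearMap.mulLeft ℚ x)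
    (g := LinearMap.mulLeft ℚ (A.twist k x) ∘ₗ A.twist k) (fun p y hy => ?_) y
  simp only [LinearMap.comp_apply, LinearMap.mulLeft_apply]
  rw [twist_of_mem k hx, twist_of_mem k hy, twist_of_mem k (SetLike.GradedMul.mul_mem hx hy),
    units_smul_mul, mul_units_smul, smul_smul, ← Int.negOnePow_add, mul_add]

theorem twist_one (k : ℤ) : A.twist k 1 = 1 := by
  rw [twist_of_mem k (SetLike.GradedOne.one_mem)]
  simp

theorem sgn_eq_twist (x : A) : A.sgn x = A.twist 1 x := by
  refine linearMap_ext_graded (ℳ := A.deg) (f := A.sgn) (g := A.twist 1) (fun n x hx => ?_) x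
  rw [sgn_of_mem A hx, twist_of_mem 1 hx, one_mul]

theorem sgn_mul (x y : A) : A.sgn (x * y) = A.sgn x * A.sgn y := by
  simp only [sgn_eq_twist, twist_mul]

theorem d_mul (x y : A) : A.d (x * y) = A.d x * y + A.sgn x * A.d y := by
  refine linearMap_ext_graded (ℳ := A.deg) (f := A.d ∘ₗ LinearMap.mulRight ℚ y)
    (g := LinearMap.mulRight ℚ y ∘ₗ A.d + LinearMap.mulRight ℚ (A.d y) ∘ₗ A.sgn)
    (fun n x hx => ?_) x
  simp [A.leibniz hx, sgn_of_mem A hx]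

theorem d_one : A.d 1 = 0 := by
  have h := A.leibniz (SetLike.GradedOne.one_mem (A := A.deg)) 1
  simpa using h

/-- The homogeneous components of a cocycle are cocycles. -/
theorem d_gradedProj {x : A} (hx : A.d x = 0) (n : ℤ) : A.d (gradedProj A.deg n x) = 0 := by
  rw [map_gradedProj A.deg A.deg 1 A.d (fun _ _ => A.d_mem), hx, map_zero]

end CDGA

namespace DGModule

variable {R : CDGA.{u}} {M : DGModule.{u, v} R}

theorem units_smul_smul (c : ℤˣ) (r : R) (x : M) : (c • r) • x = c • (r • x) := by
  rcases Int.units_eq_one_or c with e | e <;> simp [e]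

theorem d_smul (r : R) (x : M) : M.d (r • x) = R.d r • x + R.sgn r • M.d x := by
  refine graded_induction R.deg
    (motive := fun r => M.d (r • x) = R.d r • x + R.sgn r • M.d x) (by simp)
    (fun r s hr hs => ?_) (fun n r hr => ?_) r
  · simp only [add_smul, map_add, hr, hs]
    abel
  · rw [M.leibniz hr, CDGA.sgn_of_mem R hr, units_smul_smul]

theorem d_gradedProj {x : M} (hx : M.d x = 0) (n : ℤ) : M.d (gradedProj M.deg n x) = 0 := by
  rw [map_gradedProj M.deg M.deg 1 M.d (fun _ _ => M.d_mem), hx, map_zero]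

end DGModule

/-! ### Maps from semifree modules to acyclic complexes. -/

namespace DGModule

variable {R : CDGA.{u}} {Q : DGModule.{u, v} R}

/-- Induction on the elements of an `R`-span, through multiples by homogeneous elements of `R`. -/
theorem span_induction_homogeneous {s : Set Q} {motive : Q → Prop}
    (smul : ∀ p, ∀ r ∈ R.deg p, ∀ y ∈ s, motive (r • y)) (zero : motive 0)
    (add : ∀ x y, motive x → motive y → motive (x + y)) {x : Q}
    (hx : x ∈ Submodule.span R s) : motive x := by
  induction hx using Submodule.closure_induction with
  | zero => exact zero
  | add x y _ _ hx hy => exact add x y hx hy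
  | smul_mem r y hy =>
    refine graded_induction R.deg (motive := fun r => motive (r • y)) (by simpa using zero)
      (fun a b ha hb => by rw [add_smul]; exact add _ _ ha hb) (fun n r hr => smul n r hr y hy) r

/-- Maps from a semifree module to an acyclic complex are homotopic to zero. Here `ρ` is the action
of `R` on the target, and `ε` is the sign by which it commutes with the differentials. -/
theorem IsSemifree.exists_homotopy (hQ : Q.IsSemifree) {C : Type*} [AddCommGroup C] [Module ℚ C]
    (degC : ℤ → Submodule ℚ C) (dC : C →ₗ[ℚ] C) (ρ : R →ₗ[ℚ] C →ₗ[ℚ] C)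
    (ρ_mul : ∀ r s c, ρ (r * s) c = ρ r (ρ s c)) (ρ_one : ∀ c, ρ 1 c = c)
    (ρ_mem : ∀ p, ∀ r ∈ R.deg p, ∀ n, ∀ c ∈ degC n, ρ r c ∈ degC (p + n)) (ε : ℤˣ)
    (ρ_d : ∀ r c, dC (ρ r c) = ε • ρ (R.d r) c + ρ (R.sgn r) (dC c))
    (acyclic : ∀ n, ∀ c ∈ degC (n + 1), dC c = 0 → ∃ y ∈ degC n, dC y = c) (k : ℤ)
    (f : Q →ₗ[ℚ] C) (f_mem : ∀ n, ∀ x ∈ Q.deg n, f x ∈ degC (n + k + 1))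
    (f_smul : ∀ (r : R) (x : Q), f (r • x) = ρ (R.sgn r) (f x))
    (f_d : ∀ x, dC (f x) = -(ε • f (Q.d x))) :
    ∃ h : Q →ₗ[ℚ] C, (∀ n, ∀ x ∈ Q.deg n, h x ∈ degC (n + k)) ∧
      (∀ (r : R) (x : Q), h (r • x) = ρ r (h x)) ∧ ∀ x, dC (h x) = f x + ε • h (Q.d x) := by
  classical
  obtain ⟨J, e, level, he, hd⟩ := hQ
  choose q hq using he
  have degC_smul : ∀ (c : ℤˣ) n, ∀ y ∈ degC n, c • y ∈ degC n := fun c n y hy =>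
    CDGA.units_smul_mem _ _ hy
  -- `ext g` extends values on the basis compatibly with the actions; all Koszul signs are hidden in
  -- `ρ`.
  let ext : (J → C) → Q →ₗ[ℚ] C := fun g =>
    Finsupp.lsum ℚ (fun j => ρ.flip (g j)) ∘ₗ e.repr.toLinearMap.restrictScalars ℚ
  have ext_smul : ∀ g (r : R) (x : Q), ext g (r • x) = ρ r (ext g x) := by
    intro g r x
    simp only [ext, LinearMap.comp_apply, LinearMap.restrictScalars_apply,
      LinearEquiv.coe_coe, map_smul]
    induction e.repr x using Finsupp.induction_linear with
    | zero => simp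
    | add a b ha hb => rw [smul_add, map_add, map_add, map_add, ha, hb]
    | single j s =>
      rw [Finsupp.smul_single, smul_eq_mul, Finsupp.lsum_single, Finsupp.lsum_single]
      exact ρ_mul r s (g j)
  have ext_basis : ∀ g j, ext g (e j) = g j := by
    intro g j
    simp [ext, ρ_one]
  have ext_congr : ∀ g g' n, (∀ j, level j < n → g j = g' j) → ∀ x ∈
      Submodule.span R (e '' {j | level j < n}), ext g x = ext g' x := by
    intro g g' n hg x hx
    refine span_induction_homogeneous (motive := fun x => ext g x = ext g' x) ?_ (by simp)
      (fun x y hx hy => by rw [map_add, map_add, hx, hy]) hx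
    rintro p r - _ ⟨j, hj, rfl⟩
    rw [ext_smul, ext_smul, ext_basis, ext_basis, hg j hj]
  -- An element of the span need not be homogeneous, so degrees are tracked on its components.
  have ext_mem : ∀ g n, (∀ j, level j < n → g j ∈ degC (q j + k)) → ∀ x ∈
      Submodule.span R (e '' {j | level j < n}), ∀ i, ext g (gradedProj Q.deg i x) ∈
        degC (i + k) := by
    intro g n hg x hx i
    refine span_induction_homogeneous
      (motive := fun x => ext g (gradedProj Q.deg i x) ∈ degC (i + k)) ?_ (by simp)
      (fun x y hx hy => by rw [map_add, map_add]; exact add_mem hx hy) hx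
    rintro p r hr _ ⟨j, hj, rfl⟩
    by_cases hi : p + q j = i
    · rw [gradedProj_of_mem Q.deg (hi ▸ Q.smul_mem hr (hq j)), ext_smul, ext_basis, ← hi, add_assoc]
      exact ρ_mem p r hr _ _ (hg j hj)
    · rw [gradedProj_of_mem_ne Q.deg (Q.smul_mem hr (hq j)) hi, map_zero]
      exact zero_mem _
  -- The homotopy identity at `e j`. It is an equation for `y` alone once the values on lower levels
  -- are known, since `Q.d (e j)` involves only those.
  let P : J → (J → C) → C → Prop := fun j g y =>
    y ∈ degC (q j + k) ∧ dC y = f (e j) + ε • ext g (Q.d (e j))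
  -- Recursion on the level. The default `0` is for an equation without solution, which `main`
  -- excludes.
  let step : (j : J) → ((j' : J) → level j' < level j → C) → C := fun j g =>
    if h : ∃ y, P j (fun j' => if h' : level j' < level j then g j' h' else 0) y then h.choose else 0
  have wf : WellFounded fun j j' : J => level j < level j' := InvImage.wf level Nat.lt_wfRel.wf
  let H : J → C := wf.fix step
  have H_eq : ∀ j, (∃ y, P j H y) → P j H (H j) := by
    intro j hj
    have hH : H j = step j fun j' _ => H j' := wf.fix_eq step j
    have hP : ∀ y, P j (fun j' => if level j' < level j then H j' else 0) y ↔ P j H y := by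
      intro y
      have := ext_congr (fun j' => if level j' < level j then H j' else 0) H (level j)
        (fun j' hj' => if_pos hj') _ (hd j)
      simp only [P, this]
    have hex : ∃ y, P j (fun j' => if h' : level j' < level j then H j' else 0) y := by
      obtain ⟨y, hy⟩ := hj
      exact ⟨y, (hP y).2 hy⟩
    rw [hH]
    simp only [step]
    rw [dif_pos hex]
    exact (hP _).1 hex.choose_spec
  have ext_d : ∀ n, (∀ j, level j < n → P j H (H j)) → ∀ x ∈
      Submodule.span R (e '' {j | level j < n}), dC (ext H x) = f x + ε • ext H (Q.d x) := by
    intro n hn x hx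
    refine span_induction_homogeneous
      (motive := fun x => dC (ext H x) = f x + ε • ext H (Q.d x)) ?_ (by simp)
      (fun x y hx hy => by simp only [map_add, hx, hy, smul_add]; abel) hx
    rintro p r hr _ ⟨j, hj, rfl⟩
    rw [ext_smul, ρ_d, ext_basis, (hn j hj).2, Q.d_smul, map_add (ext H), ext_smul, ext_smul,
      ext_basis, f_smul, map_add, smul_add, CDGA.map_units_smul]
    abel
  have main : ∀ n j, level j < n → P j H (H j) := by
    intro n
    induction n with
    | zero => intro j hj; exact absurd hj (Nat.not_lt_zero _)
    | succ n ih =>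
      intro j hj
      have ih' : ∀ j', level j' < level j → P j' H (H j') := fun j' hj' => ih j' (by omega)
      have h1 : f (e j) + ε • ext H (Q.d (e j)) ∈ degC (q j + k + 1) := by
        refine add_mem (f_mem _ _ (hq j)) (degC_smul _ _ _ ?_)
        have := ext_mem H (level j) (fun j' hj' => (ih' j' hj').1) _ (hd j) (q j + 1)
        rwa [gradedProj_of_mem Q.deg (Q.d_mem (hq j)), add_right_comm] at this
      -- The obstruction is a cocycle because the homotopy identity already holds at `Q.d (e j)`;
      -- acyclicity then solves the equation.
      have h2 : dC (f (e j) + ε • ext H (Q.d (e j))) = 0 := by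
        rw [map_add, f_d, CDGA.map_units_smul, ext_d _ ih' _ (hd j), Q.d_d]
        simp
      obtain ⟨y, hy, hy'⟩ := acyclic _ _ h1 h2
      exact H_eq j ⟨y, hy, hy'⟩
  have top : ∀ x : Q, ∃ n, x ∈ Submodule.span R (e '' {j | level j < n}) := by
    intro x
    refine ⟨(e.repr x).support.sup level + 1, ?_⟩
    rw [Module.Basis.mem_span_image]
    intro j hj
    exact Nat.lt_succ_of_le (Finset.le_sup (f := level) hj)
  refine ⟨ext H, fun n x hx => ?_, ext_smul H, fun x => ?_⟩
  · obtain ⟨l, hl⟩ := top x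
    have := ext_mem H l (fun j' hj' => (main l j' hj').1) _ hl n
    rwa [gradedProj_of_mem Q.deg hx] at this
  · obtain ⟨l, hl⟩ := top x
    exact ext_d l (main l) x hl

end DGModule

/-! ### Contractions and the cone of the duality map. -/

namespace CDGA

variable (R : CDGA.{u})

/-- A contraction of `R` onto the span of cocycles `α k`, in which the coordinate of `x` along `α k`
is the value of the functional `U` on the product of `x` with a cocycle `β k`. -/
structure DualityContraction (M : ℤ) (U : R →ₗ[ℚ] ℚ) (K : Type w) [Fintype K] where
  homogeneous : ∀ n : ℤ, n ≠ M → ∀ x ∈ R.deg n, U x = 0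
  cycle : ∀ x, U (R.d x) = 0
  α : K → R
  β : K → R
  p : K → ℤ
  α_mem : ∀ k, α k ∈ R.deg (p k)
  β_mem : ∀ k, β k ∈ R.deg (M - p k)
  d_α : ∀ k, R.d (α k) = 0
  d_β : ∀ k, R.d (β k) = 0
  S : R →ₗ[ℚ] R
  S_mem : ∀ n, ∀ x ∈ R.deg n, S x ∈ R.deg (n - 1)
  homotopy : ∀ x, x - ∑ k, U (x * β k) • α k = R.d (S x) + S (R.d x)

/-- The functionals which vanish outside degree `q`. -/
def dualDeg (q : ℤ) : Submodule ℚ (R →ₗ[ℚ] ℚ) where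
  carrier := {l | ∀ p, p ≠ q → ∀ s ∈ R.deg p, l s = 0}
  add_mem' hf hg p hp s hs := by rw [LinearMap.add_apply, hf p hp s hs, hg p hp s hs, add_zero]
  zero_mem' _ _ _ _ := rfl
  smul_mem' c f hf p hp s hs := by rw [LinearMap.smul_apply, hf p hp s hs, smul_zero]

/-- The components of the cone of `c ↦ U (- * c)`, from `R` to its dual. -/
def coneDeg (M n : ℤ) : Submodule ℚ (R × (R →ₗ[ℚ] ℚ)) :=
  -- For `c` of degree `n` the functional `U(- * c)` lives in degree `M - n`; the cone shifts
  -- functionals by one.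
  (R.deg n).prod (R.dualDeg (M - n + 1))

/-- The differential of the cone. -/
noncomputable def coneD (U : R →ₗ[ℚ] ℚ) : R × (R →ₗ[ℚ] ℚ) →ₗ[ℚ] R × (R →ₗ[ℚ] ℚ) :=
  LinearMap.prod (R.d ∘ₗ LinearMap.fst ℚ _ _)
    ((LinearMap.mul ℚ R).flip.compr₂ U ∘ₗ LinearMap.fst ℚ _ _ -
      LinearMap.lcomp ℚ ℚ (R.sgn ∘ₗ R.d) ∘ₗ LinearMap.snd ℚ _ _)

/-- The action of `R` on the `k`-fold shift of the cone. -/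
noncomputable def coneAct (k : ℤ) : R →ₗ[ℚ] R × (R →ₗ[ℚ] ℚ) →ₗ[ℚ] R × (R →ₗ[ℚ] ℚ) :=
  LinearMap.mk₂ ℚ
    -- With the twist by `k`, a map that commutes with the actions has a first component that is
    -- `R`-linear with the Koszul sign `(-1)^{k|r|}`. Compatibility with `coneD` forces the twist by
    -- `k + 1` on functionals.
    (fun r c => (R.twist k r * c.1, c.2 ∘ₗ LinearMap.mulRight ℚ (R.twist (k + 1) r)))
    (fun r s c => by ext <;> simp [add_mul, mul_add])
    (fun a r c => by ext <;> simp)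
    (fun r c c' => by ext <;> simp [mul_add])
    (fun a r c => by ext <;> simp)

variable {R}

theorem coneD_fst (U : R →ₗ[ℚ] ℚ) (c : R × (R →ₗ[ℚ] ℚ)) : (R.coneD U c).1 = R.d c.1 := rfl

theorem coneD_snd (U : R →ₗ[ℚ] ℚ) (c : R × (R →ₗ[ℚ] ℚ)) (s : R) :
    (R.coneD U c).2 s = U (s * c.1) - c.2 (R.sgn (R.d s)) := rfl

theorem coneAct_fst (k : ℤ) (r : R) (c : R × (R →ₗ[ℚ] ℚ)) :
    (R.coneAct k r c).1 = R.twist k r * c.1 := rfl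

theorem coneAct_snd (k : ℤ) (r : R) (c : R × (R →ₗ[ℚ] ℚ)) (s : R) :
    (R.coneAct k r c).2 s = c.2 (s * R.twist (k + 1) r) := rfl

theorem cone_ext {c c' : R × (R →ₗ[ℚ] ℚ)} (h : c.1 = c'.1) (h' : ∀ s, c.2 s = c'.2 s) : c = c' :=
  Prod.ext h (LinearMap.ext h')

theorem coneAct_mul (k : ℤ) (r s : R) (c : R × (R →ₗ[ℚ] ℚ)) :
    R.coneAct k (r * s) c = R.coneAct k r (R.coneAct k s c) :=
  cone_ext (by simp [coneAct_fst, twist_mul, mul_assoc])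
    (fun t => by simp [coneAct_snd, twist_mul, mul_assoc])

theorem coneAct_one (k : ℤ) (c : R × (R →ₗ[ℚ] ℚ)) : R.coneAct k 1 c = c :=
  cone_ext (by simp [coneAct_fst, twist_one]) (fun t => by simp [coneAct_snd, twist_one])

theorem coneAct_mem (k M : ℤ) (p : ℤ) (r : R) (hr : r ∈ R.deg p) (n : ℤ)
    (c : R × (R →ₗ[ℚ] ℚ)) (hc : c ∈ R.coneDeg M n) : R.coneAct k r c ∈ R.coneDeg M (p + n) := by
  refine ⟨SetLike.GradedMul.mul_mem (twist_mem k hr) hc.1, fun q hq s hs => ?_⟩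
  rw [coneAct_snd]
  exact hc.2 (q + p) (by omega) _ (SetLike.GradedMul.mul_mem hs (twist_mem _ hr))

/-- The Leibniz rule for the shifted action: hypothesis `ρ_d` of `IsSemifree.exists_homotopy`, with
`ε = (-1)^k`. -/
theorem coneD_coneAct (U : R →ₗ[ℚ] ℚ) (k : ℤ) (r : R) (c : R × (R →ₗ[ℚ] ℚ)) :
    R.coneD U (R.coneAct k r c) =
      k.negOnePow • R.coneAct k (R.d r) c + R.coneAct k (R.sgn r) (R.coneD U c) := by
  refine cone_ext ?_ fun s => ?_
  · rw [coneD_fst, coneAct_fst, Prod.fst_add, Prod.smul_fst, coneAct_fst, coneAct_fst, coneD_fst,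
      d_mul, d_twist, sgn_twist, twist_sgn, units_smul_mul]
  · rw [coneD_snd, coneAct_snd, coneAct_fst, Prod.snd_add, Prod.smul_snd, LinearMap.add_apply,
      LinearMap.smul_apply, coneAct_snd, coneAct_snd, coneD_snd, twist_succ_sgn, d_mul, map_add,
      sgn_mul, sgn_mul, sgn_sgn, sgn_twist, d_twist, map_units_smul, sgn_twist, mul_units_smul,
      map_add, map_units_smul, mul_assoc]
    abel

theorem mul_eq_zero_of_homogeneous {U : R →ₗ[ℚ] ℚ} {M : ℤ}
    (hU : ∀ n : ℤ, n ≠ M → ∀ x ∈ R.deg n, U x = 0) {p q : ℤ} {x y : R} (hx : x ∈ R.deg p)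
    (hy : y ∈ R.deg q) (h : p + q ≠ M) : U (x * y) = 0 :=
  hU _ h _ (SetLike.GradedMul.mul_mem hx hy)

/-- Integration by parts: `U` kills the coboundary of `R.sgn x * y`. -/
theorem cycle_mul {U : R →ₗ[ℚ] ℚ} (hU : ∀ x, U (R.d x) = 0) (x y : R) :
    U (R.sgn (R.d x) * y) = U (x * R.d y) := by
  have h := hU (R.sgn x * y)
  rw [d_mul, d_sgn, sgn_sgn, neg_mul, map_add, map_neg] at h
  linarith

namespace DualityContraction

variable {M : ℤ} {U : R →ₗ[ℚ] ℚ} {K : Type w} [Fintype K] (E : R.DualityContraction M U K)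
include E

/-- Nondegeneracy: a cocycle orthogonal to the cocycles `β k` is a coboundary. -/
theorem d_S_eq {z : R} (hz : R.d z = 0) (h : ∀ k, U (z * E.β k) = 0) : R.d (E.S z) = z := by
  have := E.homotopy z
  simpa [h, hz] using this.symm

/-- The cone of the duality map is acyclic. -/
theorem cone_acyclic (n : ℤ) (c : R × (R →ₗ[ℚ] ℚ)) (hc : c ∈ R.coneDeg M (n + 1))
    (hd : R.coneD U c = 0) : ∃ y ∈ R.coneDeg M n, R.coneD U y = c := by
  obtain ⟨c, l⟩ := c
  obtain ⟨hc : c ∈ R.deg (n + 1), hl : l ∈ R.dualDeg (M - (n + 1) + 1)⟩ := hc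
  have hdc : R.d c = 0 := congrArg Prod.fst hd
  have hdl : ∀ s, U (s * c) = l (R.sgn (R.d s)) := by
    intro s
    have h : U (s * c) - l (R.sgn (R.d s)) = 0 := by
      rw [← coneD_snd U (c, l) s, hd]
      rfl
    linarith
  have hSc : E.S c ∈ R.deg n := by
    have := E.S_mem _ c hc
    rwa [add_sub_cancel_right] at this
  -- Since `β k` is a cocycle, the cone equation at `s = β k` shows that `c` is orthogonal to it.
  have hdS : R.d (E.S c) = c := by
    refine E.d_S_eq hdc fun k => ?_
    rw [R.comm hc (E.β_mem k), map_units_smul, hdl, E.d_β, map_zero, map_zero, smul_zero]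
  -- Correcting `l` by the primitive `E.S c` gives a functional that vanishes on coboundaries.
  let l₁ : R →ₗ[ℚ] ℚ := l - (LinearMap.mul ℚ R).flip.compr₂ U (E.S c)
  have l₁_apply : ∀ s, l₁ s = l s - U (s * E.S c) := fun s => rfl
  have hl₁ : ∀ p, p ≠ M - n → ∀ s ∈ R.deg p, l₁ s = 0 := by
    intro p hp s hs
    rw [l₁_apply, hl p (by omega) s hs,
      mul_eq_zero_of_homogeneous E.homogeneous hs hSc (by omega), sub_zero]
  have hl₁d : ∀ s, l₁ (R.d s) = 0 := by
    intro s
    have : R.d s = -R.sgn (R.d (R.sgn s)) := by rw [d_sgn, map_neg, neg_neg, sgn_sgn]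
    rw [this, map_neg, l₁_apply, cycle_mul E.cycle, hdS, hdl, sub_self, neg_zero]
  let r : R := ∑ k, l₁ (E.α k) • E.β k
  have hr : r ∈ R.deg n := by
    refine Submodule.sum_mem _ fun k _ => ?_
    by_cases h : E.p k = M - n
    · have := E.β_mem k
      rw [h, sub_sub_cancel] at this
      exact Submodule.smul_mem _ _ this
    · rw [hl₁ _ h _ (E.α_mem k), zero_smul]
      exact zero_mem _
  have hdr : R.d r = 0 := by simp [r, E.d_β]
  -- Applying `l₁` to the contraction formula shows that `r` represents `l₁` up to `l₁ ∘ S ∘ d`; the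
  -- second component of the witness absorbs this error.
  have hUr : ∀ s, U (s * r) = l₁ s - l₁ (E.S (R.d s)) := by
    intro s
    have h := congrArg l₁ (E.homotopy s)
    rw [map_sub, map_add, hl₁d, zero_add, map_sum] at h
    rw [← h]
    simp [r, Finset.mul_sum, mul_comm]
  refine ⟨(E.S c + r, -(l₁ ∘ₗ E.S ∘ₗ R.sgn)), ⟨add_mem hSc hr, neg_mem ?_⟩, cone_ext ?_ ?_⟩
  · intro p hp s hs
    exact hl₁ (p - 1) (by omega) _ (E.S_mem _ _ (sgn_mem hs))
  · rw [coneD_fst, map_add, hdS, hdr, add_zero]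
  · intro s
    rw [coneD_snd]
    simp only [LinearMap.neg_apply, LinearMap.comp_apply, sgn_sgn, mul_add, map_add, hUr]
    rw [l₁_apply s]
    ring

end DualityContraction

end CDGA

/-- Such a `g` factors through the image of `d`, and over a field the factor extends to `Y`. -/
theorem LinearMap.exists_comp_eq_of_ker_le {X : Type*} {Y : Type*} {Z : Type*} [AddCommGroup X]
    [Module ℚ X] [AddCommGroup Y] [Module ℚ Y] [AddCommGroup Z] [Module ℚ Z] (d : X →ₗ[ℚ] Y)
    (g : X →ₗ[ℚ] Z) (h : ∀ x, d x = 0 → g x = 0) : ∃ l : Y →ₗ[ℚ] Z, ∀ x, l (d x) = g x := by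
  obtain ⟨t, ht⟩ := d.rangeRestrict.exists_rightInverse_of_surjective d.range_rangeRestrict
  obtain ⟨l, hl⟩ := LinearMap.exists_extend (g ∘ₗ t)
  refine ⟨l, fun x => ?_⟩
  have h1 : l (d x) = g (t (d.rangeRestrict x)) := LinearMap.congr_fun hl (d.rangeRestrict x)
  have h2 : d (t (d.rangeRestrict x)) = d x :=
    congrArg Subtype.val (LinearMap.congr_fun ht (d.rangeRestrict x))
  rw [h1, ← sub_eq_zero, ← map_sub]
  exact h _ (by rw [map_sub, h2, sub_self])

/-! ### Morphisms from a semifree module to `R` and functionals on its cohomology. -/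

namespace DGModule

open CDGA

variable {R : CDGA.{u}} {Q : DGModule.{u, v} R}

theorem homDeg_twist {N : DGModule.{u, w} R} {k : ℤ} {f : Q →ₗ[ℚ] N} (hf : f ∈ Q.homDeg N k)
    (r : R) (x : Q) : f (r • x) = R.twist k r • f x := by
  refine graded_induction R.deg (motive := fun r => f (r • x) = R.twist k r • f x) (by simp)
    (fun r s hr hs => by rw [add_smul, map_add, map_add, hr, hs, add_smul])
    (fun n r hr => by rw [hf.2 n r hr x, twist_of_mem k hr, units_smul_smul]) r

theorem morphisms_d {N : DGModule.{u, w} R} {k : ℤ} {f : Q →ₗ[ℚ] N} (hf : f ∈ Q.morphisms N k)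
    (x : Q) : N.d (f x) = k.negOnePow • f (Q.d x) :=
  sub_eq_zero.1 (LinearMap.congr_fun hf.2 x)

variable {M : ℤ} {U : R →ₗ[ℚ] ℚ} {K : Type x} [Fintype K]

/-- Integration by parts for `l`, which kills `Q.d (R.twist (k + 1) s • x)`. It makes `dualMap l k`
compatible with the differentials. -/
theorem dual_sgn_d {l : Q →ₗ[ℚ] ℚ} (hl : ∀ x, l (Q.d x) = 0) (k : ℤ) (s : R) (x : Q) :
    l (R.twist k (R.sgn (R.d s)) • x) = k.negOnePow • l (R.twist k s • Q.d x) := by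
  have h := hl (R.twist (k + 1) s • x)
  rw [d_smul, d_twist, sgn_twist_succ, map_add, units_smul_smul, map_units_smul,
    Int.negOnePow_succ, Units.neg_smul] at h
  rw [twist_sgn, sub_eq_zero.1 ((neg_add_eq_sub _ _).symm.trans h), units_smul_cancel]

/-- The functional `s ↦ l ((-1)^{k |s|} s x)`, depending on `x`. -/
noncomputable def dualMap (l : Q →ₗ[ℚ] ℚ) (k : ℤ) : Q →ₗ[ℚ] R →ₗ[ℚ] ℚ :=
  LinearMap.mk₂ ℚ (fun x s => l (R.twist k s • x)) (fun x y s => by rw [smul_add, map_add])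
    (fun c x s => by rw [smul_algebra_smul_comm, map_smul])
    (fun x s t => by rw [map_add, add_smul, map_add])
    (fun c x s => by rw [(R.twist k).map_smul, smul_assoc, l.map_smul])

theorem dualMap_apply (l : Q →ₗ[ℚ] ℚ) (k : ℤ) (x : Q) (s : R) :
    dualMap l k x s = l (R.twist k s • x) := rfl

theorem dualMap_smul (l : Q →ₗ[ℚ] ℚ) (k : ℤ) (r : R) (x : Q) (s : R) :
    dualMap l k (r • x) s = dualMap l k x (s * R.twist (k + 1) (R.sgn r)) := by
  rw [dualMap_apply, dualMap_apply, twist_succ_sgn, twist_mul, twist_twist, mul_smul]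

theorem dualMap_mem {l : Q →ₗ[ℚ] ℚ} {q : ℤ} (hl : ∀ n, n ≠ q → ∀ x ∈ Q.deg n, l x = 0) (k : ℤ)
    {n : ℤ} {x : Q} (hx : x ∈ Q.deg n) {j : ℤ} (h : j = q - n) : dualMap l k x ∈ R.dualDeg j := by
  intro p hp s hs
  exact hl (p + n) (by omega) _ (Q.smul_mem (twist_mem k hs) hx)

/-- Every functional on a semifree module which vanishes on coboundaries is induced, on cocycles, by
a morphism to `R`. -/
theorem IsSemifree.exists_morphism (E : R.DualityContraction M U K) (hQ : Q.IsSemifree) {q k : ℤ}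
    (hk : k = M - q) (l : Q →ₗ[ℚ] ℚ) (hl : ∀ n, n ≠ q → ∀ x ∈ Q.deg n, l x = 0)
    (hld : ∀ x, l (Q.d x) = 0) :
    ∃ f ∈ Q.morphisms R.self k, ∀ x, Q.d x = 0 → U (f x) = l x := by
  -- A null-homotopy of `(0, dualMap l k)` in the cone is a lift of `dualMap l k` through the
  -- duality map, up to homotopy. The lift is its first component.
  obtain ⟨h, h_mem, h_smul, h_d⟩ := hQ.exists_homotopy (R.coneDeg M) (R.coneD U) (R.coneAct k)
    (coneAct_mul k) (coneAct_one k) (coneAct_mem k M) k.negOnePow (coneD_coneAct U k)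
    (E.cone_acyclic) k (LinearMap.prod 0 (dualMap l k))
    (fun n x hx => ⟨zero_mem _, dualMap_mem hl k hx (by omega)⟩)
    (fun r x => cone_ext (by simp [coneAct_fst]) fun s => by
      rw [coneAct_snd]
      exact dualMap_smul l k r x s)
    (fun x => cone_ext (by simp [coneD_fst]) fun s => by
      rw [coneD_snd]
      change U (s * 0) - l (R.twist k (R.sgn (R.d s)) • x) =
        -(k.negOnePow • l (R.twist k s • Q.d x))
      rw [dual_sgn_d hld, mul_zero, map_zero, zero_sub])
  refine ⟨LinearMap.fst ℚ _ _ ∘ₗ h, ⟨⟨fun n x hx => (h_mem n x hx).1, fun p r hr x => ?_⟩, ?_⟩,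
    fun x hx => ?_⟩
  · have := congrArg Prod.fst (h_smul r x)
    rw [coneAct_fst, twist_of_mem k hr, units_smul_mul] at this
    exact this
  · refine LinearMap.ext fun x => sub_eq_zero.2 ?_
    have := congrArg Prod.fst (h_d x)
    rw [coneD_fst, Prod.fst_add, Prod.smul_fst] at this
    exact this.trans (zero_add _)
  -- At `s = 1` and a cocycle `x`, all terms of the second component vanish except `U (f x)` and `l
  -- x`.
  · have := congrArg (fun c => c.2 1) (h_d x)
    simp only [coneD_snd, d_one, map_zero, one_mul, sub_zero, hx, smul_zero, add_zero] at this
    refine this.trans ?_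
    change l (R.twist k 1 • x) = l x
    rw [twist_one, one_smul]

/-- A morphism from a semifree module to `R` on whose values at cocycles `U` vanishes is homotopic
to zero. -/
theorem IsSemifree.mem_coboundaries (E : R.DualityContraction M U K) (hQ : Q.IsSemifree) {k : ℤ}
    (f : Q →ₗ[ℚ] R.self) (hf : f ∈ Q.morphisms R.self k) (hfU : ∀ x, Q.d x = 0 → U (f x) = 0) :
    f ∈ Q.coboundaries R.self k := by
  obtain ⟨k, rfl⟩ : ∃ j, k = j + 1 := ⟨k - 1, by ring⟩
  let f' : Q →ₗ[ℚ] R := f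
  have f'_mem : ∀ n, ∀ x ∈ Q.deg n, f' x ∈ R.deg (n + (k + 1)) := hf.1.1
  have f'_smul : ∀ r x, f' (r • x) = R.twist (k + 1) r * f' x := homDeg_twist hf.1
  have f'_d : ∀ x, R.d (f' x) = (k + 1).negOnePow • f' (Q.d x) := morphisms_d hf
  -- Vanishing of `U ∘ f'` on cocycles gives a primitive for the image of `f` in the dual.
  obtain ⟨l₀, hl₀⟩ := Q.d.exists_comp_eq_of_ker_le (U ∘ₗ f') hfU
  -- The projection makes the primitive homogeneous; nothing is lost, because `U ∘ f'` is supported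
  -- in degree `M - k - 1`.
  let l : Q →ₗ[ℚ] ℚ := -(k.negOnePow • (l₀ ∘ₗ gradedProj Q.deg (M - k)))
  have hl : ∀ n, n ≠ M - k → ∀ x ∈ Q.deg n, l x = 0 := by
    intro n hn x hx
    simp [l, gradedProj_of_mem_ne Q.deg hx hn]
  have hld : ∀ x, l (Q.d x) = -(k.negOnePow • U (f' x)) := by
    intro x
    refine linearMap_ext_graded (ℳ := Q.deg) (f := l ∘ₗ Q.d)
      (g := -(k.negOnePow • (U ∘ₗ f'))) (fun n x hx => ?_) x
    by_cases h : n + 1 = M - k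
    · simp [l, gradedProj_of_mem Q.deg (h ▸ Q.d_mem hx), hl₀]
    · rw [LinearMap.comp_apply, hl _ h _ (Q.d_mem hx)]
      simp [E.homogeneous (n + (k + 1)) (by omega) _ (f'_mem n x hx)]
  -- The pair lifts `f` to the cone compatibly with the differentials, and the first component of
  -- its null-homotopy is one for `f`.
  obtain ⟨h, h_mem, h_smul, h_d⟩ := hQ.exists_homotopy (R.coneDeg M) (R.coneD U) (R.coneAct k)
    (coneAct_mul k) (coneAct_one k) (coneAct_mem k M) k.negOnePow (coneD_coneAct U k)
    (E.cone_acyclic) k (LinearMap.prod f' (dualMap l k))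
    (fun n x hx => ⟨by simpa [add_assoc] using f'_mem n x hx, dualMap_mem hl k hx (by omega)⟩)
    (fun r x => cone_ext (by simp [coneAct_fst, twist_sgn, f'_smul]) fun s => by
      rw [coneAct_snd]
      exact dualMap_smul l k r x s)
    (fun x => cone_ext (by simp [coneD_fst, f'_d, Int.negOnePow_succ]) fun s => by
      rw [coneD_snd]
      change U (s * f' x) - l (R.twist k (R.sgn (R.d s)) • x) =
        -(k.negOnePow • l (R.twist k s • Q.d x))
      -- Expanded by the Leibniz rule, this instance is the second component of the required
      -- compatibility.
      have h := hld (R.twist (k + 1) s • x)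
      rw [d_smul, d_twist, sgn_twist_succ, map_add, units_smul_smul, map_units_smul, f'_smul,
        twist_twist, Int.negOnePow_succ, Units.neg_smul] at h
      rw [twist_sgn]
      rcases Int.units_eq_one_or k.negOnePow with e | e <;> simp [e] at h ⊢ <;> linarith)
  refine ⟨LinearMap.fst ℚ _ _ ∘ₗ h, ⟨fun n x hx => ?_, fun p r hr x => ?_⟩, ?_⟩
  · rw [add_sub_cancel_right]
    exact (h_mem n x hx).1
  · rw [add_sub_cancel_right]
    have := congrArg Prod.fst (h_smul r x)
    rw [coneAct_fst, twist_of_mem k hr, units_smul_mul] at this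
    exact this
  · rw [add_sub_cancel_right]
    refine LinearMap.ext fun x => sub_eq_iff_eq_add.2 ?_
    exact congrArg Prod.fst (h_d x)

end DGModule

/-! ### Contraction of a Poincaré duality algebra onto its cohomology. -/

namespace CDGA

section Existence

variable {A : CDGA.{u}}

/-- A linear map of degree `-1` which lifts the coboundaries. -/
theorem exists_lift_coboundaries (A : CDGA.{u}) : ∃ t : A →ₗ[ℚ] A,
    (∀ n, ∀ x ∈ A.deg n, t x ∈ A.deg (n - 1)) ∧ ∀ x, A.d (t (A.d x)) = A.d x := by
  obtain ⟨t₀, ht₀⟩ := A.d.rangeRestrict.exists_rightInverse_of_surjective A.d.range_rangeRestrict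
  obtain ⟨t, ht⟩ := LinearMap.exists_extend t₀
  have htd : ∀ x, A.d (t (A.d x)) = A.d x := fun x => by
    have h1 : t (A.d x) = t₀ (A.d.rangeRestrict x) := LinearMap.congr_fun ht (A.d.rangeRestrict x)
    rw [h1]
    exact congrArg Subtype.val (LinearMap.congr_fun ht₀ (A.d.rangeRestrict x))
  -- Keeping only the degree `-1` part of `t` preserves the lifting property, because `A.d` is
  -- homogeneous.
  refine ⟨gradedMap A.deg fun n => gradedProj A.deg (n - 1) ∘ₗ t, fun n x hx => ?_,
    linearMap_ext_graded (ℳ := A.deg) (f := A.d ∘ₗ gradedMap A.deg _ ∘ₗ A.d) (g := A.d)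
      fun n x hx => ?_⟩
  · rw [gradedMap_of_mem A.deg _ hx]
    exact gradedProj_mem _ _ _
  · rw [LinearMap.comp_apply, LinearMap.comp_apply, gradedMap_of_mem A.deg _ (A.d_mem hx),
      LinearMap.comp_apply, map_gradedProj A.deg A.deg 1 A.d (fun _ _ => A.d_mem), htd,
      sub_add_cancel, gradedProj_of_mem A.deg (A.d_mem hx)]

variable {m : ℕ} {u : A →ₗ[ℚ] ℚ} {J : Type w} [Fintype J] (E : DualBases A m u J)

/-- The class of a cocycle is the combination of the `a j` with coefficients `u (x * b j)`. -/
theorem DualBases.sub_sum_mem_range (hu : A.IsPoincareDuality m u) {x : A} (hx : A.d x = 0) :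
    x - ∑ j, u (x * E.b j) • E.a j ∈ LinearMap.range A.d := by
  have h : A.cls x hx ∈ Submodule.span ℚ (Set.range fun j => A.cls (E.a j) (E.d_a j)) := by
    rw [E.span_eq_top]
    trivial
  obtain ⟨c, hc⟩ := (Submodule.mem_span_range_iff_exists_fun ℚ).1 h
  have hc' : (Submodule.Quotient.mk ⟨x, LinearMap.mem_ker.2 hx⟩ : A.Cohomology) =
      Submodule.Quotient.mk (∑ j, c j • ⟨E.a j, LinearMap.mem_ker.2 (E.d_a j)⟩) := by
    refine hc.symm.trans ?_
    rw [← Submodule.mkQ_apply, map_sum]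
    rfl
  have hr := (Submodule.Quotient.eq _).1 hc'
  have hr' : x - ∑ j, c j • E.a j ∈ LinearMap.range A.d := by
    have : ((⟨x, LinearMap.mem_ker.2 hx⟩ - ∑ j, c j • ⟨E.a j, LinearMap.mem_ker.2 (E.d_a j)⟩ :
        LinearMap.ker A.d) : A) ∈ LinearMap.range A.d := hr
    simpa using this
  -- Pairing with `b k` reads off the coefficient, since coboundaries pair to zero with cocycles.
  suffices H : ∀ k, u (x * E.b k) = c k by simpa only [H] using hr'
  intro k
  obtain ⟨y, hy⟩ := hr'
  have e : x = A.d y + ∑ j, c j • E.a j := by rw [hy, sub_add_cancel]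
  have h0 : u (A.d y * E.b k) = 0 := by
    have := hu.cycle (y * E.b k)
    rwa [d_mul, E.d_b, mul_zero, add_zero] at this
  rw [e, add_mul, map_add, h0, zero_add, Finset.sum_mul, map_sum, Finset.sum_eq_single k]
  · simp [E.pairing_self]
  · intro j _ hj
    simp [E.pairing_ne j k hj]
  · simp

/-- A Poincaré duality algebra contracts onto the span of a basis of its cohomology. -/
theorem DualBases.exists_contraction (hu : A.IsPoincareDuality m u) :
    ∃ C : A.DualityContraction m u J, C.α = E.a ∧ C.β = E.b ∧ C.p = E.p := by
  obtain ⟨t, ht, htd⟩ := A.exists_lift_coboundaries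
  let π : A →ₗ[ℚ] A := ∑ j, (u ∘ₗ LinearMap.mulRight ℚ (E.b j)).smulRight (E.a j)
  have π_apply : ∀ x, π x = ∑ j, u (x * E.b j) • E.a j := fun x => by simp [π]
  have π_mem : ∀ n, ∀ x ∈ A.deg n, π x ∈ A.deg n := by
    intro n x hx
    rw [π_apply]
    refine Submodule.sum_mem _ fun j _ => ?_
    by_cases h : E.p j = n
    · exact h ▸ Submodule.smul_mem _ _ (E.a_mem j)
    · rw [mul_eq_zero_of_homogeneous hu.homogeneous hx (E.b_mem j) (by omega), zero_smul]
      exact zero_mem _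
  have π_d : ∀ x, π (A.d x) = 0 := by
    intro x
    rw [π_apply]
    refine Finset.sum_eq_zero fun j _ => ?_
    have := hu.cycle (x * E.b j)
    rw [d_mul, E.d_b, mul_zero, add_zero] at this
    rw [this, zero_smul]
  have d_π : ∀ x, A.d (π x) = 0 := fun x => by simp [π_apply, E.d_a]
  have π_a : ∀ j, π (E.a j) = E.a j := by
    intro j
    rw [π_apply, Finset.sum_eq_single j]
    · simp [E.pairing_self]
    · intro k _ hk
      rw [E.pairing_ne j k hk.symm, zero_smul]
    · simp
  have π_π : ∀ x, π (π x) = π x := by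
    intro x
    rw [π_apply x, map_sum]
    simp [π_a]
  have π_range : ∀ x, A.d x = 0 → ∃ y, A.d y = x - π x := by
    intro x hx
    rw [π_apply]
    exact E.sub_sum_mem_range hu hx
  let g : A →ₗ[ℚ] A := LinearMap.id - π
  have g_apply : ∀ x, g x = x - π x := fun _ => rfl
  have g_mem : ∀ n, ∀ x ∈ A.deg n, g x ∈ A.deg n := fun n x hx => sub_mem hx (π_mem n x hx)
  refine ⟨{
    homogeneous := hu.homogeneous
    cycle := hu.cycle
    α := E.a
    β := E.b
    p := E.p
    α_mem := E.a_mem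
    β_mem := E.b_mem
    d_α := E.d_a
    d_β := E.d_b
    -- The cocycle `x - t (d x)` becomes a coboundary under `g` and is lifted by `t`, so `d (S x) =
    -- g (x - t (d x))`. The outer `g` makes `S (d x)` equal to the missing term `g (t (d x))`.
    S := g ∘ₗ t ∘ₗ g ∘ₗ (LinearMap.id - t ∘ₗ A.d)
    S_mem := fun n x hx => g_mem _ _ (ht _ _ (g_mem _ _ (sub_mem hx ?_)))
    homotopy := fun x => ?_ }, rfl, rfl, rfl⟩
  · have := ht _ _ (A.d_mem hx)
    rwa [add_sub_cancel_right] at this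
  · rw [← π_apply]
    have hz : A.d (x - t (A.d x)) = 0 := by rw [map_sub, htd, sub_self]
    obtain ⟨y, hy⟩ := π_range _ hz
    simp only [LinearMap.comp_apply, LinearMap.sub_apply, LinearMap.id_apply, A.d_d, map_zero,
      sub_zero]
    have h1 : A.d (g (t (g (x - t (A.d x))))) = x - t (A.d x) - π x + π (t (A.d x)) := by
      rw [g_apply (t _), map_sub, d_π, sub_zero, g_apply, ← hy, htd, hy, map_sub]
      abel
    have h2 : g (t (g (A.d x))) = t (A.d x) - π (t (A.d x)) := by
      rw [g_apply (A.d x), π_d, sub_zero, g_apply]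
    rw [h1, h2]
    abel

end Existence

/-! ### Tensor products of contractions. -/

section Tensor

variable {A : CDGA.{u}} {B : CDGA.{v}}

/-- The bilinear map `(x, y) ↦ x ⊗ y`. -/
noncomputable def tmul (A : CDGA.{u}) (B : CDGA.{v}) : A →ₗ[ℚ] B →ₗ[ℚ] A.tensor B :=
  (TensorProduct.mk ℚ A B).compr₂ (GradedTensorProduct.of ℚ A.deg B.deg).toLinearMap

theorem tmul_mem_deg {p q n : ℤ} {a : A} {b : B} (ha : a ∈ A.deg p) (hb : b ∈ B.deg q)
    (h : p + q = n) : tmul A B a b ∈ (A.tensor B).deg n :=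
  tmul_mem' ha hb h

theorem linearMap_ext_tensor {Y : Type*} [AddCommGroup Y] [Module ℚ Y]
    {f g : A.tensor B →ₗ[ℚ] Y}
    (h : ∀ p q, ∀ a ∈ A.deg p, ∀ b ∈ B.deg q, f (tmul A B a b) = g (tmul A B a b))
    (x : A.tensor B) : f x = g x := by
  refine tensor_induction (motive := fun x : A.tensor B => f x = g x)
    (fun p q a b ha hb => h p q a ha b hb) ((map_zero f).trans (map_zero g).symm)
    (fun x y hx hy => ?_) x
  exact (map_add f x y).trans ((congrArg₂ (· + ·) hx hy).trans (map_add g x y).symm)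

theorem mem_of_tensorDeg {Y : Type*} [AddCommGroup Y] [Module ℚ Y] {f : A.tensor B →ₗ[ℚ] Y}
    {n : ℤ} {N : Submodule ℚ Y}
    (h : ∀ p q, p + q = n → ∀ a ∈ A.deg p, ∀ b ∈ B.deg q, f (tmul A B a b) ∈ N)
    {x : A.tensor B} (hx : x ∈ (A.tensor B).deg n) : f x ∈ N := by
  refine tensorDeg_induction (motive := fun x : A.tensor B => f x ∈ N)
    (fun p q a b ha hb e => h p q e a ha b hb) ((map_zero f).symm ▸ zero_mem _)
    (fun x y hx hy => ?_) hx
  exact (map_add f x y).symm ▸ add_mem hx hy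

theorem d_tmul (x : A) (y : B) :
    (A.tensor B).d (tmul A B x y) = tmul A B (A.d x) y + tmul A B (A.sgn x) (B.d y) := rfl

theorem d_tmul_eq_zero {x : A} {y : B} (hx : A.d x = 0) (hy : B.d y = 0) :
    (A.tensor B).d (tmul A B x y) = 0 := by
  simp [d_tmul, hx, hy]

theorem tmul_mul {q p : ℤ} (a : A) {b : B} {a' : A} (b' : B) (hb : b ∈ B.deg q)
    (ha' : a' ∈ A.deg p) : tmul A B a b * tmul A B a' b' =
      (q * p).negOnePow • tmul A B (a * a') (b * b') :=
  tmul_mul_tmul a b' hb ha'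

/-- The functional `x ⊗ y ↦ f x * g y`. -/
noncomputable def tensorFunctional (f : A →ₗ[ℚ] ℚ) (g : B →ₗ[ℚ] ℚ) : A.tensor B →ₗ[ℚ] ℚ :=
  LinearMap.mul' ℚ ℚ ∘ₗ TensorProduct.map f g ∘ₗ
    (GradedTensorProduct.of ℚ A.deg B.deg).symm.toLinearMap

theorem tensorFunctional_tmul (f : A →ₗ[ℚ] ℚ) (g : B →ₗ[ℚ] ℚ) (x : A) (y : B) :
    tensorFunctional f g (tmul A B x y) = f x * g y := rfl

theorem tensorFunctional_mul (f : A →ₗ[ℚ] ℚ) (g : B →ₗ[ℚ] ℚ) {q p : ℤ} (a : A) {b : B} {a' : A}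
    (b' : B) (hb : b ∈ B.deg q) (ha' : a' ∈ A.deg p) :
    tensorFunctional f g (tmul A B a b * tmul A B a' b') =
      (q * p).negOnePow • (f (a * a') * g (b * b')) := by
  rw [tmul_mul a b' hb ha', map_units_smul, tensorFunctional_tmul]

/-- The map `x ⊗ y ↦ f x ⊗ g y`, without signs. -/
noncomputable def tensorMap (f : A →ₗ[ℚ] A) (g : B →ₗ[ℚ] B) : A.tensor B →ₗ[ℚ] A.tensor B :=
  (GradedTensorProduct.of ℚ A.deg B.deg).toLinearMap ∘ₗ TensorProduct.map f g ∘ₗ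
    (GradedTensorProduct.of ℚ A.deg B.deg).symm.toLinearMap

theorem sgn_comp_of_degree_neg_one {s : A →ₗ[ℚ] A} (hs : ∀ n, ∀ x ∈ A.deg n, s x ∈ A.deg (n - 1))
    (x : A) : A.sgn (s x) = -s (A.sgn x) := by
  refine linearMap_ext_graded (ℳ := A.deg) (f := A.sgn ∘ₗ s) (g := -(s ∘ₗ A.sgn))
    (fun n x hx => ?_) x
  simp [sgn_of_mem A hx, sgn_of_mem A (hs n x hx), Int.negOnePow_sub]

theorem sgn_comp_of_degree_zero {s : A →ₗ[ℚ] A} (hs : ∀ n, ∀ x ∈ A.deg n, s x ∈ A.deg n)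
    (x : A) : A.sgn (s x) = s (A.sgn x) := by
  refine linearMap_ext_graded (ℳ := A.deg) (f := A.sgn ∘ₗ s) (g := s ∘ₗ A.sgn)
    (fun n x hx => ?_) x
  simp [sgn_of_mem A hx, sgn_of_mem A (hs n x hx)]

namespace DualityContraction

variable {M M' : ℤ} {f : A →ₗ[ℚ] ℚ} {g : B →ₗ[ℚ] ℚ} {K : Type w} {K' : Type x}
  [Fintype K] [Fintype K'] (E : A.DualityContraction M f K)

/-- The projection on the span of the `α k`. -/
noncomputable def proj : A →ₗ[ℚ] A :=
  ∑ k, (f ∘ₗ LinearMap.mulRight ℚ (E.β k)).smulRight (E.α k)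

theorem proj_apply (x : A) : E.proj x = ∑ k, f (x * E.β k) • E.α k := by simp [proj]

theorem proj_mem {n : ℤ} {x : A} (hx : x ∈ A.deg n) : E.proj x ∈ A.deg n := by
  rw [proj_apply]
  refine Submodule.sum_mem _ fun k _ => ?_
  by_cases h : E.p k = n
  · exact h ▸ Submodule.smul_mem _ _ (E.α_mem k)
  · rw [mul_eq_zero_of_homogeneous E.homogeneous hx (E.β_mem k) (by omega), zero_smul]
    exact zero_mem _

theorem proj_d (x : A) : E.proj (A.d x) = 0 := by
  rw [proj_apply]
  refine Finset.sum_eq_zero fun k _ => ?_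
  have := E.cycle (x * E.β k)
  rw [d_mul, E.d_β, mul_zero, add_zero] at this
  rw [this, zero_smul]

theorem d_proj (x : A) : A.d (E.proj x) = 0 := by simp [proj_apply, E.d_α]

theorem d_S (x : A) : A.d (E.S x) = x - E.proj x - E.S (A.d x) := by
  rw [eq_sub_iff_add_eq, proj_apply, ← E.homotopy]

/-- The tensor product of two contractions. -/
noncomputable def tensor (E' : B.DualityContraction M' g K') :
    (A.tensor B).DualityContraction (M + M') (tensorFunctional f g) (K × K') where
  homogeneous := by
    intro n hn x hx
    refine (Submodule.mem_bot ℚ).1 (mem_of_tensorDeg (fun p q h a ha b hb => ?_) hx)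
    rw [Submodule.mem_bot, tensorFunctional_tmul]
    by_cases hp : p = M
    · rw [E'.homogeneous q (by omega) b hb, mul_zero]
    · rw [E.homogeneous p hp a ha, zero_mul]
  cycle := by
    refine linearMap_ext_tensor (f := tensorFunctional f g ∘ₗ (A.tensor B).d) (g := 0)
      fun p q a ha b hb => ?_
    rw [LinearMap.comp_apply, d_tmul, map_add, tensorFunctional_tmul, tensorFunctional_tmul,
      E.cycle, E'.cycle, mul_zero, zero_mul, add_zero, LinearMap.zero_apply]
  -- This sign cancels the Koszul sign `(-1)^{|b||β|}` of `(a ⊗ b)(β ⊗ β')`: here `|β| = M - p`, and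
  -- `|b| = p'` whenever the coefficient is nonzero.
  α k := (E'.p k.2 * (M - E.p k.1)).negOnePow • tmul A B (E.α k.1) (E'.α k.2)
  β k := tmul A B (E.β k.1) (E'.β k.2)
  p k := E.p k.1 + E'.p k.2
  α_mem k := units_smul_mem _ _ (tmul_mem_deg (E.α_mem k.1) (E'.α_mem k.2) rfl)
  β_mem k := tmul_mem_deg (E.β_mem k.1) (E'.β_mem k.2) (by ring)
  d_α k := by
    rw [map_units_smul, d_tmul_eq_zero (E.d_α k.1) (E'.d_α k.2), smul_zero]
  d_β k := d_tmul_eq_zero (E.d_β k.1) (E'.d_β k.2)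
  -- Contract the first factor, then the second over the image of the first projection; `A.sgn` is
  -- the sign of moving `E'.S` past the first factor.
  S := tensorMap E.S LinearMap.id + tensorMap (E.proj ∘ₗ A.sgn) E'.S
  S_mem n x hx := mem_of_tensorDeg (fun p q h a ha b hb => add_mem
    (tmul_mem_deg (E.S_mem _ _ ha) hb (by omega))
    (tmul_mem_deg (E.proj_mem (sgn_mem ha)) (E'.S_mem _ _ hb) (by omega))) hx
  homotopy := by
    let S : A.tensor B →ₗ[ℚ] A.tensor B :=
      tensorMap E.S LinearMap.id + tensorMap (E.proj ∘ₗ A.sgn) E'.S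
    let G : A.tensor B →ₗ[ℚ] A.tensor B := ∑ k : K × K',
      (tensorFunctional f g ∘ₗ LinearMap.mulRight ℚ (tmul A B (E.β k.1) (E'.β k.2))).smulRight
        ((E'.p k.2 * (M - E.p k.1)).negOnePow • tmul A B (E.α k.1) (E'.α k.2))
    have G_apply : ∀ x, G x = ∑ k : K × K',
        tensorFunctional f g (x * tmul A B (E.β k.1) (E'.β k.2)) •
          ((E'.p k.2 * (M - E.p k.1)).negOnePow • tmul A B (E.α k.1) (E'.α k.2)) := by
      intro x
      rw [LinearMap.sum_apply]
      rfl
    suffices H : ∀ x, (LinearMap.id - G : A.tensor B →ₗ[ℚ] A.tensor B) x =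
        ((A.tensor B).d ∘ₗ S + S ∘ₗ (A.tensor B).d) x by
      intro x
      rw [← G_apply]
      exact H x
    refine linearMap_ext_tensor fun p q a ha b hb => ?_
    have hG : G (tmul A B a b) = tmul A B (E.proj a) (E'.proj b) := by
      rw [G_apply, proj_apply, proj_apply, map_sum (tmul A B), LinearMap.sum_apply,
        Fintype.sum_prod_type]
      refine Finset.sum_congr rfl fun k _ => ?_
      rw [map_sum]
      refine Finset.sum_congr rfl fun k' _ => ?_
      rw [map_smul, map_smul, LinearMap.smul_apply, smul_smul,
        tensorFunctional_mul f g a _ hb (E.β_mem k)]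
      by_cases hq : q = E'.p k'
      · subst hq
        rcases Int.units_eq_one_or (E'.p k' * (M - E.p k)).negOnePow with e | e <;>
          rw [e] <;> simp [mul_comm]
      · rw [mul_eq_zero_of_homogeneous E'.homogeneous hb (E'.β_mem k') (by omega), mul_zero,
          zero_mul, smul_zero, zero_smul, zero_smul]
    have hS : ∀ (a : A) (b : B), S (tmul A B a b) =
        tmul A B (E.S a) b + tmul A B (E.proj (A.sgn a)) (E'.S b) := fun a b => rfl
    have hSd : S ((A.tensor B).d (tmul A B a b)) = tmul A B (E.S (A.d a)) b +
        (tmul A B (E.S (A.sgn a)) (B.d b) + tmul A B (E.proj a) (E'.S (B.d b))) := by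
      rw [d_tmul, map_add, hS, hS, sgn_sgn, ← neg_neg (A.sgn (A.d a)), ← d_sgn,
        map_neg E.proj, proj_d, neg_zero, map_zero, LinearMap.zero_apply, add_zero]
    have hdS : (A.tensor B).d (S (tmul A B a b)) =
        tmul A B (a - E.proj a - E.S (A.d a)) b + -tmul A B (E.S (A.sgn a)) (B.d b) +
          tmul A B (E.proj a) (b - E'.proj b - E'.S (B.d b)) := by
      rw [hS, map_add, d_tmul, d_tmul, E.d_S, E'.d_S, d_proj, map_zero, LinearMap.zero_apply,
        zero_add, sgn_comp_of_degree_neg_one E.S_mem, map_neg, LinearMap.neg_apply,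
        sgn_comp_of_degree_zero (fun _ _ => E.proj_mem), sgn_sgn]
    rw [LinearMap.sub_apply, LinearMap.id_apply, LinearMap.add_apply, LinearMap.comp_apply,
      LinearMap.comp_apply, hG, hSd, hdS]
    simp only [map_sub, LinearMap.sub_apply]
    abel

end DualityContraction

end Tensor

end CDGA

/-! ### Low degrees of a Sullivan model and the fundamental class. -/

namespace CDGA

variable {A : CDGA.{u}} {V : ℤ → Submodule ℚ A}

theorem freeLift_range (hV : ∀ n, V n ≤ A.deg n) :
    (A.freeLift V hV).range = Algebra.adjoin ℚ (⋃ n, (V n : Set A)) := by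
  have key : ∀ z, A.freeLift V hV (RingQuot.mkAlgHom ℚ (FreeGCA.Rel V) z) =
      TensorAlgebra.lift ℚ (DirectSum.toModule ℚ ℤ A fun n => (V n).subtype) z :=
    fun z => RingQuot.liftAlgHom_mkAlgHom_apply ℚ _ _ z
  have h : (A.freeLift V hV).range =
      (TensorAlgebra.lift ℚ (DirectSum.toModule ℚ ℤ A fun n => (V n).subtype)).range := by
    ext x
    constructor
    · rintro ⟨y, rfl⟩
      obtain ⟨z, rfl⟩ := RingQuot.mkAlgHom_surjective ℚ (FreeGCA.Rel V) y
      exact ⟨z, (key z).symm⟩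
    · rintro ⟨z, rfl⟩
      exact ⟨_, key z⟩
  rw [h, TensorAlgebra.range_lift]
  refine le_antisymm (Algebra.adjoin_le ?_) (Algebra.adjoin_mono ?_)
  · rintro _ ⟨y, rfl⟩
    induction y using DirectSum.induction_on with
    | zero => simp
    | of n y =>
      have : DirectSum.toModule ℚ ℤ A (fun n => (V n).subtype) (DirectSum.of (fun n => V n) n y) =
        y := by
        rw [← DirectSum.lof_eq_of ℚ, DirectSum.toModule_lof]
        rfl
      rw [this]
      exact Algebra.subset_adjoin (Set.mem_iUnion.2 ⟨n, y.2⟩)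
    | add y z hy hz =>
      rw [map_add]
      exact add_mem hy hz
  · refine Set.iUnion_subset fun n y hy => ⟨DirectSum.lof ℚ ℤ (fun n => V n) n ⟨y, hy⟩, ?_⟩
    rw [DirectSum.toModule_lof]
    rfl

namespace IsSullivanModel

variable (hV : A.IsSullivanModel V)
include hV

/-- A monomial in elements of `V` is `1` or has positive degree. Projecting this description to
degree `n` yields `A^n = 0` for `n < 0` and `A^0 = ℚ`. -/
theorem mem_span (x : A) :
    x ∈ Submodule.span ℚ ({1} ∪ {y : A | ∃ n : ℤ, 1 ≤ n ∧ y ∈ A.deg n}) := by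
  have h : x ∈ Algebra.adjoin ℚ (⋃ n, (V n : Set A)) := by
    rw [← freeLift_range hV.le_deg]
    exact hV.bijective.2 x
  rw [← Subalgebra.mem_toSubmodule, Algebra.adjoin_eq_span] at h
  refine Submodule.span_mono (fun y hy => ?_) h
  induction hy using Submonoid.closure_induction with
  | mem y hy =>
    obtain ⟨n, hn⟩ := Set.mem_iUnion.1 hy
    by_cases h2 : n < 2
    · rw [hV.eq_bot n h2] at hn
      rw [(Submodule.mem_bot ℚ).1 hn]
      exact Or.inr ⟨1, le_rfl, zero_mem _⟩
    · exact Or.inr ⟨n, by omega, hV.le_deg n hn⟩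
  | one => exact Or.inl rfl
  | mul y z _ _ hy hz =>
    rcases hy with hy | ⟨p, hp, hy⟩
    · rw [hy, one_mul]
      exact hz
    · rcases hz with hz | ⟨q, hq, hz⟩
      · rw [hz, mul_one]
        exact Or.inr ⟨p, hp, hy⟩
      · exact Or.inr ⟨p + q, by omega, SetLike.GradedMul.mul_mem hy hz⟩

theorem eq_zero_of_neg {n : ℤ} (hn : n < 0) {x : A} (hx : x ∈ A.deg n) : x = 0 := by
  rw [← gradedProj_of_mem A.deg hx]
  refine LinearMap.mem_ker.1 ((Submodule.span_le (p := LinearMap.ker (gradedProj A.deg n))).2 ?_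
    (hV.mem_span x))
  rintro y (rfl | ⟨p, hp, hy⟩)
  · exact gradedProj_of_mem_ne A.deg SetLike.GradedOne.one_mem hn.ne'
  · exact gradedProj_of_mem_ne A.deg hy (by omega)

theorem exists_smul_one {x : A} (hx : x ∈ A.deg 0) : ∃ c : ℚ, c • (1 : A) = x := by
  rw [← Submodule.mem_span_singleton, ← gradedProj_of_mem A.deg hx]
  refine (Submodule.span_le (p := (Submodule.span ℚ {(1 : A)}).comap (gradedProj A.deg 0))).2 ?_
    (hV.mem_span x)
  rintro y (rfl | ⟨p, hp, hy⟩)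
  · rw [SetLike.mem_coe, Submodule.mem_comap, gradedProj_of_mem A.deg SetLike.GradedOne.one_mem]
    exact Submodule.mem_span_singleton_self 1
  · rw [SetLike.mem_coe, Submodule.mem_comap, gradedProj_of_mem_ne A.deg hy (by omega)]
    exact zero_mem _

/-- The augmentation `∧V → ℚ` that kills `V` sends `1` to `1`. -/
theorem one_ne_zero : (1 : A) ≠ 0 := by
  intro h
  have h1 : (1 : FreeGCA V) = 0 := hV.bijective.1 (by rw [map_one, map_zero, h])
  let aug : FreeGCA V →ₐ[ℚ] ℚ := RingQuot.liftAlgHom ℚ ⟨TensorAlgebra.algebraMapInv, by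
    rintro _ _ ⟨p, q, x, y⟩
    rcases Int.units_eq_one_or (p * q).negOnePow with e | e <;>
      simp [e, TensorAlgebra.algebraMapInv]⟩
  have := congrArg aug h1
  simp at this

variable {m : ℕ} {u : A →ₗ[ℚ] ℚ} (hu : A.IsPoincareDuality m u)
include hu

/-- For degree reasons `x` can pair nontrivially only with `A^0 = ℚ`, so `u x = 0` makes it
orthogonal to everything. Thus `H^m` is at most a line. -/
theorem mem_range_of_apply_eq_zero {x : A} (hx : x ∈ A.deg m) (hd : A.d x = 0) (h : u x = 0) :
    x ∈ LinearMap.range A.d := by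
  refine hu.nondegenerate x hd fun y _ => ?_
  refine induction_of_gradedProj A.deg (motive := fun y => u (x * y) = 0) (by simp)
    (fun y z hy hz => by rw [mul_add, map_add, hy, hz, add_zero]) y fun n => ?_
  by_cases hn : n = 0
  · subst hn
    obtain ⟨c, hc⟩ := hV.exists_smul_one (gradedProj_mem A.deg 0 y)
    rw [← hc, mul_smul_comm, mul_one, map_smul, h, smul_zero]
  · exact mul_eq_zero_of_homogeneous hu.homogeneous hx (gradedProj_mem A.deg n y) (by omega)

/-- Otherwise `u` vanishes on all cocycles and nondegeneracy makes `1` a coboundary, although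
`A^{-1} = 0` and `1 ≠ 0`. -/
theorem exists_fundamental : ∃ x ∈ A.deg m, A.d x = 0 ∧ u x = 1 := by
  by_contra! hne
  have h0 : ∀ x, A.d x = 0 → u x = 0 := by
    intro x hx
    refine induction_of_gradedProj A.deg (motive := fun y => u y = 0) (by simp)
      (fun y z hy hz => by rw [map_add, hy, hz, add_zero]) x fun n => ?_
    by_cases hn : n = m
    · subst hn
      by_contra hx0
      refine hne ((u (gradedProj A.deg m x))⁻¹ • gradedProj A.deg m x)
        (Submodule.smul_mem _ _ (gradedProj_mem _ _ _)) ?_ ?_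
      · rw [map_smul, d_gradedProj hx, smul_zero]
      · rw [map_smul, smul_eq_mul, inv_mul_cancel₀ hx0]
    · exact hu.homogeneous n hn _ (gradedProj_mem _ _ _)
  obtain ⟨y, hy⟩ := hu.nondegenerate 1 d_one fun y hy => by rw [one_mul, h0 y hy]
  refine hV.one_ne_zero ?_
  have h1 : gradedProj A.deg (-1 + 1) (A.d y) = 1 := by
    rw [hy, neg_add_cancel]
    exact gradedProj_of_mem A.deg SetLike.GradedOne.one_mem
  rw [← h1, ← map_gradedProj A.deg A.deg 1 A.d (fun _ _ => A.d_mem),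
    hV.eq_zero_of_neg (by norm_num) (gradedProj_mem A.deg (-1) y), map_zero]

end IsSullivanModel

end CDGA

/-! ### `Ext^m` is a line. -/

namespace DGModule

open CDGA

variable {A : CDGA.{u}} {V : ℤ → Submodule ℚ A} (hV : A.IsSullivanModel V) {m : ℕ} {u : A →ₗ[ℚ] ℚ}
  (hu : A.IsPoincareDuality m u) {Q : DGModule.{u, v} (A.tensor A)} {ψ : Q →ₗ[ℚ] A.mul.dgModule}
  (hψ : IsSemifreeResolution ψ)

include hψ in
theorem resolution_d (x : Q) : ψ (Q.d x) = A.d (ψ x) := by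
  have h := morphisms_d hψ.2.1 x
  rw [Int.negOnePow_zero, one_smul] at h
  exact h.symm

include hV hu hψ in
/-- On cocycles, the composite of a morphism of degree `m` with the functional `u ⊗ u` is a multiple
of `u ∘ ψ`. -/
theorem functional_eq {f : Q →ₗ[ℚ] (A.tensor A).self} (hf : f ∈ Q.morphisms (A.tensor A).self m)
    {K : Type*} [Fintype K]
    (E : (A.tensor A).DualityContraction (m + m) (tensorFunctional u u) K) {x₀ : Q}
    (hx₀ : Q.d x₀ = 0) {a : A} (ha : a ∈ A.deg m) (hda : A.d a = 0) (hua : u a = 1)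
    (hax : a - (show A from ψ x₀) ∈ LinearMap.range A.d) {x : Q} (hx : Q.d x = 0) :
    tensorFunctional u u (f x) = u (ψ x) * tensorFunctional u u (f x₀) := by
  let ψ' : Q →ₗ[ℚ] A := ψ
  let f' : Q →ₗ[ℚ] A.tensor A := f
  change tensorFunctional u u (f' x) = u (ψ' x) * tensorFunctional u u (f' x₀)
  replace hax : a - ψ' x₀ ∈ LinearMap.range A.d := hax
  refine induction_of_gradedProj Q.deg
    (motive := fun x => tensorFunctional u u (f' x) = u (ψ' x) * tensorFunctional u u (f' x₀))
    (by simp) (fun y z hy hz => by simp only [map_add, hy, hz, add_mul]) x fun n => ?_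
  have hdx := d_gradedProj hx n
  generalize hy : gradedProj Q.deg n x = y at hdx
  have hyn : y ∈ Q.deg n := hy ▸ gradedProj_mem Q.deg n x
  have hψy : ψ' y ∈ A.deg n := by
    have := hψ.2.1.1.1 n y hyn
    rwa [add_zero] at this
  -- Only degree `m` matters: `f` has degree `m`, and `u ⊗ u` is supported in degree `2m`.
  by_cases hn : n = m
  · subst hn
    have h1 : ψ' y - u (ψ' y) • a ∈ LinearMap.range A.d := by
      refine hV.mem_range_of_apply_eq_zero hu (sub_mem hψy (Submodule.smul_mem _ _ ha)) ?_ ?_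
      · have : A.d (ψ' y) = 0 := (resolution_d hψ y).symm.trans (by rw [hdx]; exact map_zero ψ)
        rw [map_sub, map_smul, hda, smul_zero, sub_zero]
        exact this
      · rw [map_sub, map_smul, hua, smul_eq_mul, mul_one, sub_self]
    -- Since `ψ` is injective on cohomology, `y` is cohomologous to `u (ψ' y) • x₀` already in `Q`.
    have h2 : ψ' (y - u (ψ' y) • x₀) ∈ LinearMap.range A.d := by
      have := add_mem h1 (Submodule.smul_mem _ (u (ψ' y)) hax)
      rwa [smul_sub, sub_add_sub_cancel, ← map_smul, ← map_sub] at this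
    obtain ⟨z, hz⟩ := hψ.2.2.1 (y - u (ψ' y) • x₀) (by simp [hdx, hx₀]) h2
    have h3 : f' (Q.d z) = (m : ℤ).negOnePow • (A.tensor A).d (f' z) := by
      have h : (A.tensor A).d (f' z) = (m : ℤ).negOnePow • f' (Q.d z) := morphisms_d hf z
      rw [h, units_smul_cancel]
    have h4 : tensorFunctional u u (f' (y - u (ψ' y) • x₀)) = 0 := by
      rw [← hz, h3, map_units_smul, E.cycle, smul_zero]
    rw [map_sub, map_sub, map_smul, map_smul, sub_eq_zero] at h4
    exact h4
  · rw [hu.homogeneous n hn _ hψy, zero_mul]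
    exact E.homogeneous (n + m) (by omega) _ (hf.1.1 n y hyn)

include hV hu hψ in
/-- A morphism of degree `m` is homotopic to zero if and only if the functional `u ⊗ u` vanishes on
its value at the fundamental class. -/
theorem mem_coboundaries_iff {f : Q →ₗ[ℚ] (A.tensor A).self}
    (hf : f ∈ Q.morphisms (A.tensor A).self m) {K : Type*} [Fintype K]
    (E : (A.tensor A).DualityContraction (m + m) (tensorFunctional u u) K) {x₀ : Q}
    (hx₀ : Q.d x₀ = 0) {a : A} (ha : a ∈ A.deg m) (hda : A.d a = 0) (hua : u a = 1)
    (hax : a - (show A from ψ x₀) ∈ LinearMap.range A.d) :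
    f ∈ Q.coboundaries (A.tensor A).self m ↔ tensorFunctional u u (f x₀) = 0 := by
  constructor
  · rintro ⟨h, -, rfl⟩
    let h' : Q →ₗ[ℚ] A.tensor A := h
    have e : Q.homD (A.tensor A).self (m - 1) h x₀ =
        (A.tensor A).d (h' x₀) - ((m : ℤ) - 1).negOnePow • h' (Q.d x₀) := rfl
    rw [e, hx₀, map_zero, smul_zero, sub_zero, E.cycle]
  · intro h0
    refine hψ.1.mem_coboundaries E f hf fun x hx => ?_
    rw [functional_eq hV hu hψ hf E hx₀ ha hda hua hax hx, h0, mul_zero]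

include hu hψ in
-- The functional `c • (u ∘ ψ)` is supported in degree `m` and kills coboundaries; as `2m - m = m`,
-- it is realised by a morphism of degree `m`.
theorem exists_morphism_apply_eq {K : Type*} [Fintype K]
    (E : (A.tensor A).DualityContraction (m + m) (tensorFunctional u u) K) (c : ℚ) :
    ∃ f ∈ Q.morphisms (A.tensor A).self m, ∀ x, Q.d x = 0 →
      tensorFunctional u u (f x) = c * u (ψ x) := by
  let ψ' : Q →ₗ[ℚ] A := ψ
  refine hψ.1.exists_morphism E (q := m) (by ring) (c • (u ∘ₗ ψ')) (fun n hn x hx => ?_)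
    fun x => ?_
  · have h : ψ' x ∈ A.deg (n + 0) := hψ.2.1.1.1 n x hx
    rw [add_zero] at h
    simp [hu.homogeneous n hn _ h]
  · have h : ψ' (Q.d x) = A.d (ψ' x) := resolution_d hψ x
    simp [h, hu.cycle]

include hV hu hψ in
/-- `Ext^m` is one-dimensional. -/
theorem nonempty_homCohomology_equiv {K : Type*} [Fintype K]
    (E : (A.tensor A).DualityContraction (m + m) (tensorFunctional u u) K) :
    Nonempty (Q.homCohomology (A.tensor A).self m ≃ₗ[ℚ] ℚ) := by
  obtain ⟨a, ha, hda, hua⟩ := hV.exists_fundamental hu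
  obtain ⟨x₀, hx₀, hax⟩ := hψ.2.2.2 a hda
  -- The coordinate on `Ext^m` is the value of `u ⊗ u` at a cocycle over the fundamental class.
  let ev : Q.morphisms (A.tensor A).self m →ₗ[ℚ] ℚ :=
    { toFun := fun f => tensorFunctional u u (f.1 x₀)
      map_add' := fun f g => map_add (tensorFunctional u u) _ _
      map_smul' := fun c f => map_smul (tensorFunctional u u) c _ }
  have hker : (Q.coboundaries (A.tensor A).self m).submoduleOf (Q.morphisms (A.tensor A).self m) =
      LinearMap.ker ev := by
    ext f
    exact mem_coboundaries_iff hV hu hψ f.2 E hx₀ ha hda hua hax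
  have hsurj : Function.Surjective ev := by
    intro c
    obtain ⟨f, hf, hfx⟩ := exists_morphism_apply_eq hu hψ E c
    refine ⟨⟨f, hf⟩, (hfx x₀ hx₀).trans ?_⟩
    obtain ⟨y, hy⟩ := hax
    have : u (ψ x₀) = 1 := by
      have h' : u a - u (ψ x₀) = 0 :=
        (map_sub u _ _).symm.trans ((congrArg u hy).symm.trans (hu.cycle y))
      linarith
    rw [this, mul_one]
  exact ⟨(Submodule.quotEquivOfEq _ _ hker).trans (ev.quotKerEquivOfSurjective hsurj)⟩

end DGModule

/-! ### Graded subspaces and adapted homogeneous bases. -/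

section GradedSubmodules

variable {X : Type*} [AddCommGroup X] [Module ℚ X] (ℳ : ℤ → Submodule ℚ X)
  [DirectSum.Decomposition ℳ]

/-- A subspace which contains the homogeneous components of its elements. -/
def IsGradedSubspace (N : Submodule ℚ X) : Prop := ∀ n, ∀ x ∈ N, gradedProj ℳ n x ∈ N

variable {ℳ}

theorem isGradedSubspace_span {s : Set X} (hs : ∀ x ∈ s, ∃ n, x ∈ ℳ n) :
    IsGradedSubspace ℳ (Submodule.span ℚ s) := by
  intro n x hx
  induction hx using Submodule.span_induction with
  | mem x hx =>
    obtain ⟨k, hk⟩ := hs x hx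
    by_cases h : k = n
    · subst h
      rw [gradedProj_of_mem ℳ hk]
      exact Submodule.subset_span hx
    · rw [gradedProj_of_mem_ne ℳ hk h]
      exact zero_mem _
  | zero => simp
  | add x y _ _ hx hy => rw [map_add]; exact add_mem hx hy
  | smul c x _ hx => rw [map_smul]; exact Submodule.smul_mem _ _ hx

theorem IsGradedSubspace.le_span {N : Submodule ℚ X} (hN : IsGradedSubspace ℳ N) :
    N ≤ Submodule.span ℚ {x | x ∈ N ∧ ∃ n, x ∈ ℳ n} := fun x hx =>
  induction_of_gradedProj ℳ (motive := fun x => x ∈ Submodule.span ℚ _) (zero_mem _)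
    (fun _ _ => add_mem) x fun n =>
      Submodule.subset_span ⟨hN n x hx, n, gradedProj_mem ℳ n x⟩

/-- An exhausted increasing sequence of graded subspaces has an adapted homogeneous basis. -/
theorem exists_adapted_basis {G : ℕ → Submodule ℚ X} (G_zero : G 0 = ⊥) (hG : Monotone G)
    (hgr : ∀ n, IsGradedSubspace ℳ (G n)) : ∃ B : ℕ → Set X, Monotone B ∧ B 0 = ∅ ∧
      (∀ n, ∀ x ∈ B n, ∃ k, x ∈ ℳ k) ∧ (∀ n, Submodule.span ℚ (B n) = G n) ∧
        LinearIndepOn ℚ id (⋃ n, B n) := by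
  let h : ℕ → Set X := fun n => {x | x ∈ G n ∧ ∃ k, x ∈ ℳ k}
  have h_mono : ∀ n, h n ⊆ h (n + 1) := fun n x hx => ⟨hG n.le_succ hx.1, hx.2⟩
  -- A graded subspace is spanned by its homogeneous vectors, so a basis of one stage extends to the
  -- next using these only.
  have step : ∀ n, ∀ s : {s : Set X // LinearIndepOn ℚ id s ∧ s ⊆ h n},
      ∃ b : {s : Set X // LinearIndepOn ℚ id s ∧ s ⊆ h (n + 1)}, s.1 ⊆ b.1 ∧
        h (n + 1) ⊆ Submodule.span ℚ b.1 := by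
    intro n s
    obtain ⟨b, hb, hsb, hspan, hli⟩ :=
      exists_linearIndepOn_id_extension s.2.1 (s.2.2.trans (h_mono n))
    exact ⟨⟨b, hli, hb⟩, hsb, hspan⟩
  choose next next_sub next_span using step
  let B : (n : ℕ) → {s : Set X // LinearIndepOn ℚ id s ∧ s ⊆ h n} := fun n =>
    Nat.rec ⟨∅, linearIndepOn_empty _ _, Set.empty_subset _⟩ next n
  have B_mono : Monotone fun n => (B n).1 := monotone_nat_of_le_succ fun n => next_sub n (B n)
  refine ⟨fun n => (B n).1, B_mono, rfl, fun n x hx => ((B n).2.2 hx).2, fun n => ?_,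
    linearIndepOn_iUnion_of_directed B_mono.directed_le fun n => (B n).2.1⟩
  refine le_antisymm (Submodule.span_le.2 fun x hx => ((B n).2.2 hx).1) ?_
  cases n with
  | zero => rw [G_zero]; exact bot_le
  | succ n => exact (hgr (n + 1)).le_span.trans (Submodule.span_le.2 (next_span n (B n)))

end GradedSubmodules

/-! ### Relative Sullivan algebras are semifree. -/

namespace CDGA

open scoped Pointwise

variable {R : CDGA.{u}} {P : CDGA.{v}}

theorem isGradedSubspace_mul {N N' : Submodule ℚ P} (hN : IsGradedSubspace P.deg N)
    (hN' : IsGradedSubspace P.deg N') : IsGradedSubspace P.deg (N * N') := by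
  intro n x hx
  have h : N * N' ≤ Submodule.span ℚ ({x | x ∈ N ∧ ∃ n, x ∈ P.deg n} *
      {x | x ∈ N' ∧ ∃ n, x ∈ P.deg n} : Set P) := by
    rw [← Submodule.span_mul_span]
    exact mul_le_mul' hN.le_span hN'.le_span
  have h' : Submodule.span ℚ ({x | x ∈ N ∧ ∃ n, x ∈ P.deg n} *
      {x | x ∈ N' ∧ ∃ n, x ∈ P.deg n} : Set P) ≤ N * N' := by
    rw [← Submodule.span_mul_span]
    exact mul_le_mul' (Submodule.span_le.2 fun x hx => hx.1)
      (Submodule.span_le.2 fun x hx => hx.1)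
  refine h' (isGradedSubspace_span (ℳ := P.deg) ?_ n x (h hx))
  rintro _ ⟨y, ⟨-, p, hy⟩, z, ⟨-, q, hz⟩, rfl⟩
  exact ⟨p + q, SetLike.GradedMul.mul_mem hy hz⟩

theorem mul_comm_le {N N' : Submodule ℚ P} (hN : IsGradedSubspace P.deg N)
    (hN' : IsGradedSubspace P.deg N') : N * N' ≤ N' * N := by
  refine Submodule.mul_le.2 fun x hx y hy => ?_
  refine induction_of_gradedProj P.deg (motive := fun x => x * y ∈ N' * N) (by simp)
    (fun a b ha hb => by rw [add_mul]; exact add_mem ha hb) x fun p => ?_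
  refine induction_of_gradedProj P.deg (motive := fun y => gradedProj P.deg p x * y ∈ N' * N)
    (by simp) (fun a b ha hb => by rw [mul_add]; exact add_mem ha hb) y fun q => ?_
  rw [P.comm (gradedProj_mem P.deg p x) (gradedProj_mem P.deg q y)]
  exact units_smul_mem _ _ (Submodule.mul_mem_mul (hN' q y hy) (hN p x hx))

theorem sgn_mem_of_isGradedSubspace {N : Submodule ℚ P} (hN : IsGradedSubspace P.deg N) {x : P}
    (hx : x ∈ N) : P.sgn x ∈ N := by
  refine induction_of_gradedProj P.deg (motive := fun x => P.sgn x ∈ N) (by simp)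
    (fun a b ha hb => by rw [map_add]; exact add_mem ha hb) x fun p => ?_
  rw [sgn_of_mem P (gradedProj_mem P.deg p x)]
  exact units_smul_mem _ _ (hN p x hx)

/-- The image of `R` in `P`. -/
noncomputable def Hom.image (i : R.Hom P) : Submodule ℚ P := Subalgebra.toSubmodule i.toAlgHom.range

theorem Hom.image_mul_image (i : R.Hom P) : i.image * i.image = i.image :=
  Subalgebra.isIdempotentElem_toSubmodule _

theorem Hom.isGradedSubspace_image (i : R.Hom P) : IsGradedSubspace P.deg i.image := by
  rintro n _ ⟨r, rfl⟩
  refine ⟨gradedProj R.deg n r, ?_⟩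
  have := map_gradedProj R.deg P.deg 0 i.toLinearMap
    (fun n x hx => by rw [add_zero]; exact i.map_deg hx) n r
  rw [add_zero] at this
  exact this

/-- The subalgebra generated by a graded subspace. -/
noncomputable def generated (W : ℤ → Submodule ℚ P) : Submodule ℚ P :=
  Subalgebra.toSubmodule (Algebra.adjoin ℚ (⋃ n, (W n : Set P)))

theorem isGradedSubspace_generated {W : ℤ → Submodule ℚ P} (hW : ∀ n, W n ≤ P.deg n) :
    IsGradedSubspace P.deg (generated W) := by
  rw [generated, Algebra.adjoin_eq_span]
  refine isGradedSubspace_span fun x hx => ?_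
  induction hx using Submonoid.closure_induction with
  | mem x hx =>
    obtain ⟨n, hn⟩ := Set.mem_iUnion.1 hx
    exact ⟨n, hW n hn⟩
  | one => exact ⟨0, SetLike.GradedOne.one_mem⟩
  | mul x y _ _ hx hy =>
    obtain ⟨p, hp⟩ := hx
    obtain ⟨q, hq⟩ := hy
    exact ⟨p + q, SetLike.GradedMul.mul_mem hp hq⟩

/-- The largest filtration of the algebra generated by `W` such that the differential maps each
stage to the `R`-span of the previous one. -/
noncomputable def filtration (i : R.Hom P) (W : ℤ → Submodule ℚ P) : ℕ → Submodule ℚ P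
  | 0 => ⊥
  | n + 1 => generated W ⊓ (i.image * filtration i W n).comap P.d

section Filtration

variable (i : R.Hom P) (W : ℤ → Submodule ℚ P)

theorem filtration_mono : Monotone (filtration i W) := by
  refine monotone_nat_of_le_succ fun n => ?_
  induction n with
  | zero => exact bot_le
  | succ n ih =>
    exact inf_le_inf_left _ (Submodule.comap_mono (mul_le_mul' le_rfl ih))

theorem filtration_le (n : ℕ) : filtration i W n ≤ generated W := by
  cases n with
  | zero => exact bot_le
  | succ n => exact inf_le_left

variable {W}

theorem isGradedSubspace_filtration (hW : ∀ n, W n ≤ P.deg n) (n : ℕ) :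
    IsGradedSubspace P.deg (filtration i W n) := by
  induction n with
  | zero =>
    intro n x hx
    rw [(Submodule.mem_bot ℚ).1 hx, map_zero]
    exact zero_mem _
  | succ n ih =>
    intro k x hx
    refine ⟨isGradedSubspace_generated hW k x hx.1, ?_⟩
    rw [SetLike.mem_coe, Submodule.mem_comap,
      map_gradedProj P.deg P.deg 1 P.d (fun _ _ => P.d_mem)]
    exact isGradedSubspace_mul i.isGradedSubspace_image ih _ _ hx.2

/-- By the Leibniz rule each term of `d (x y)` lowers one of the two indices; the factor from `R` is
moved to the front by graded commutativity. -/
theorem filtration_mul (hW : ∀ n, W n ≤ P.deg n) (N : ℕ) : ∀ a b, a + b = N →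
    filtration i W a * filtration i W b ≤ filtration i W N := by
  induction N with
  | zero =>
    intro a b h
    obtain rfl : a = 0 := by omega
    rw [filtration, Submodule.bot_mul]
  | succ N ih =>
    rintro (_ | a) (_ | b) h
    · rw [filtration, Submodule.bot_mul]; exact bot_le
    · rw [filtration, Submodule.bot_mul]; exact bot_le
    · rw [filtration.eq_1, Submodule.mul_bot]; exact bot_le
    · refine Submodule.mul_le.2 fun x hx y hy => ⟨?_, ?_⟩
      · exact mul_mem (S := Subalgebra ℚ P) hx.1 hy.1
      · rw [SetLike.mem_coe, Submodule.mem_comap, d_mul]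
        refine add_mem ?_ ?_
        · have hdx : P.d x ∈ i.image * filtration i W a := hx.2
          have := Submodule.mul_mem_mul hdx hy
          rw [mul_assoc] at this
          exact mul_le_mul' le_rfl (ih a (b + 1) (by omega)) this
        · have hdy : P.d y ∈ i.image * filtration i W b := hy.2
          have := Submodule.mul_mem_mul
            (sgn_mem_of_isGradedSubspace (isGradedSubspace_filtration i hW (a + 1)) hx) hdy
          rw [← mul_assoc] at this
          have := mul_le_mul' (mul_comm_le (isGradedSubspace_filtration i hW (a + 1))
            i.isGradedSubspace_image) le_rfl this
          rw [mul_assoc] at this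
          exact mul_le_mul' le_rfl (ih (a + 1) b (by omega)) this

theorem one_mem_filtration : (1 : P) ∈ filtration i W 1 :=
  ⟨one_mem (Algebra.adjoin ℚ (⋃ n, (W n : Set P))), by simp [d_one]⟩

theorem image_le_mul_filtration : i.image ≤ i.image * filtration i W 1 := by
  intro x hx
  simpa using Submodule.mul_mem_mul hx (one_mem_filtration i (W := W))

/-- The filtration is multiplicative and `i.image` moves past it, so the union of the `R`-spans of
its stages is a subalgebra. -/
theorem adjoin_le_mul_filtration (hW : ∀ n, W n ≤ P.deg n) {s : Set P}
    (hs : ∀ x ∈ s, ∃ n, x ∈ i.image * filtration i W n) {x : P} (hx : x ∈ Algebra.adjoin ℚ s) :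
    ∃ n, x ∈ i.image * filtration i W n := by
  induction hx using Algebra.adjoin_induction with
  | mem x hx => exact hs x hx
  | algebraMap c =>
    exact ⟨1, image_le_mul_filtration i (algebraMap_mem i.toAlgHom.range c)⟩
  | add x y _ _ hx hy =>
    obtain ⟨a, ha⟩ := hx
    obtain ⟨b, hb⟩ := hy
    refine ⟨max a b, add_mem ?_ ?_⟩
    · exact mul_le_mul' le_rfl (filtration_mono i W (le_max_left a b)) ha
    · exact mul_le_mul' le_rfl (filtration_mono i W (le_max_right a b)) hb
  | mul x y _ _ hx hy =>
    obtain ⟨a, ha⟩ := hx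
    obtain ⟨b, hb⟩ := hy
    refine ⟨a + b, ?_⟩
    have h := Submodule.mul_mem_mul ha hb
    have h1 : i.image * filtration i W a * (i.image * filtration i W b) ≤
        i.image * (filtration i W a * filtration i W b) := by
      calc i.image * filtration i W a * (i.image * filtration i W b)
          = i.image * (filtration i W a * i.image) * filtration i W b := by simp only [mul_assoc]
        _ ≤ i.image * (i.image * filtration i W a) * filtration i W b :=
          mul_le_mul' (mul_le_mul' le_rfl (mul_comm_le
            (isGradedSubspace_filtration i hW a) i.isGradedSubspace_image)) le_rfl
        _ = i.image * (filtration i W a * filtration i W b) := by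
          rw [← mul_assoc, i.image_mul_image, mul_assoc]
    exact mul_le_mul' le_rfl (filtration_mul i hW _ a b rfl) (h1 h)

end Filtration

namespace IsRelativeSullivan

variable {i : R.Hom P} {W : ℤ → Submodule ℚ P} (h : IsRelativeSullivan i W)
include h

/-- Induction along the nilpotence filtration places each element of `W` in some stage, and
multiplicativity carries this to `∧W`. -/
theorem generated_le {x : P} (hx : x ∈ generated W) : ∃ n, x ∈ filtration i W n := by
  obtain ⟨F, hF, hFW, hF0, hFs⟩ := h.nilpotent
  have hFgen : ∀ k n, ∀ x ∈ F k n, x ∈ generated W := fun k n x hx =>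
    Algebra.subset_adjoin (Set.mem_iUnion.2 ⟨n, hFW n ▸ (le_iSup (fun k => F k n) k) hx⟩)
  have hk : ∀ k n, ∀ x ∈ F k n, ∃ l, x ∈ filtration i W l := by
    intro k
    induction k with
    | zero =>
      intro n x hx
      -- Stage `1` contains the unit, so its `R`-span contains `R`; an element of `∧W` with
      -- differential in `R` is therefore in stage `2`.
      exact ⟨2, hFgen 0 n x hx, image_le_mul_filtration i (hF0 n x hx)⟩
    | succ k ih =>
      intro n x hx
      obtain ⟨l, hl⟩ := adjoin_le_mul_filtration i h.le_deg (s := Set.range i ∪ ⋃ j, (F k j : Set P))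
        (by
          rintro y (hy | hy)
          · exact ⟨1, image_le_mul_filtration i hy⟩
          · obtain ⟨j, hj⟩ := Set.mem_iUnion.1 hy
            obtain ⟨l, hl⟩ := ih j y hj
            refine ⟨l, ?_⟩
            have h1 : (1 : P) ∈ i.image := one_mem i.toAlgHom.range
            simpa using Submodule.mul_mem_mul h1 hl)
        (hFs k n x hx)
      exact ⟨l + 1, hFgen _ n x hx, hl⟩
  have hW : ∀ n, ∀ x ∈ W n, ∃ l, x ∈ filtration i W l := by
    intro n x hx
    rw [← hFW n, Submodule.mem_iSup_of_directed _
      (Monotone.directed_le fun a b hab => hF hab n)] at hx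
    obtain ⟨k, hx⟩ := hx
    exact hk k n x hx
  refine Algebra.adjoin_induction (p := fun x _ => ∃ l, x ∈ filtration i W l) ?_ ?_ ?_ ?_ hx
  · intro x hx
    obtain ⟨n, hn⟩ := Set.mem_iUnion.1 hx
    exact hW n x hn
  · intro c
    refine ⟨1, ?_⟩
    rw [Algebra.algebraMap_eq_smul_one]
    exact Submodule.smul_mem _ _ (one_mem_filtration i)
  · rintro x y _ _ ⟨a, ha⟩ ⟨b, hb⟩
    exact ⟨max a b, add_mem (filtration_mono i W (le_max_left a b) ha)
      (filtration_mono i W (le_max_right a b) hb)⟩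
  · rintro x y _ _ ⟨a, ha⟩ ⟨b, hb⟩
    exact ⟨a + b, filtration_mul i h.le_deg _ a b rfl (Submodule.mul_mem_mul ha hb)⟩

/-- Elements of the fibre algebra which are linearly independent over `ℚ` are linearly independent
over `R`. -/
theorem linearIndependent {B : Set P} (hB : B ⊆ generated W) (hli : LinearIndepOn ℚ id B) :
    LinearIndependent R (fun b : B => (show i.dgModule from b.1)) := by
  have hr : ∀ b : B, ∃ c, P.freeLift W h.le_deg c = b.1 := fun b => by
    have := hB b.2
    rw [generated, ← freeLift_range h.le_deg] at this
    exact this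
  choose c hc using hr
  have hcli : LinearIndependent ℚ c := by
    refine LinearIndependent.of_comp (P.freeLift W h.le_deg).toLinearMap ?_
    have : (P.freeLift W h.le_deg).toLinearMap ∘ c = fun b : B => b.1 := funext hc
    rw [this]
    exact hli
  let L : R ⊗[ℚ] FreeGCA W →ₗ[ℚ] P := TensorProduct.lift
    ((LinearMap.mul ℚ P).compl₁₂ i.toLinearMap (P.freeLift W h.le_deg).toLinearMap)
  -- The isomorphism `R ⊗ ∧W → P` is `R`-linear, which reduces the claim to the elements `1 ⊗ c b`,
  -- where flat base change applies.
  let L' : R ⊗[ℚ] FreeGCA W →ₗ[R] i.dgModule :=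
    { toFun := L
      map_add' := L.map_add
      map_smul' := fun r z => by
        change L (r • z) = i r * L z
        induction z using TensorProduct.induction_on with
        | zero => simp
        | add y z hy hz => rw [smul_add, map_add, hy, hz, map_add, mul_add]
        | tmul s y =>
          change i (r * s) * P.freeLift W h.le_deg y = i r * (i s * P.freeLift W h.le_deg y)
          rw [map_mul, mul_assoc] }
  have hL' : LinearMap.ker L' = ⊥ := LinearMap.ker_eq_bot.2 h.bijective.1
  have h2 := (Module.Flat.linearIndependent_one_tmul (S := R) hcli).map' L' hL'
  convert h2 using 2 with b
  change b.1 = i 1 * P.freeLift W h.le_deg (c b)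
  rw [hc, map_one, one_mul]

/-- A relative Sullivan algebra is semifree over its base. -/
theorem isSemifree : i.dgModule.IsSemifree := by
  classical
  obtain ⟨B, B_mono, B_zero, B_hom, B_span, B_li⟩ := exists_adapted_basis (ℳ := P.deg)
    (G := filtration i W) rfl (filtration_mono i W) (isGradedSubspace_filtration i h.le_deg)
  have hB : ⋃ n, B n ⊆ generated W := by
    refine Set.iUnion_subset fun n x hx => filtration_le i W n ?_
    rw [← B_span]
    exact Submodule.subset_span hx
  have image_mul : ∀ N : Set i.dgModule, ∀ x : i.dgModule,
      (show P from x) ∈ i.image * Submodule.span ℚ (show Set P from N) →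
        x ∈ Submodule.span R N := by
    intro N x hx
    refine Submodule.mul_induction_on (C := fun x : P => (show i.dgModule from x) ∈
      Submodule.span R N) hx ?_ fun a b => add_mem
    rintro _ ⟨r, rfl⟩ y hy
    exact Submodule.smul_mem (Submodule.span R N) r (x := (show i.dgModule from y))
      (Submodule.span_subset_span ℚ R N hy)
  have hspan : ⊤ ≤ Submodule.span R
      (Set.range fun b : ↥(⋃ n, B n) => (show i.dgModule from b.1)) := by
    rintro x -
    obtain ⟨z, rfl⟩ := h.bijective.2 x
    induction z using TensorProduct.induction_on with
    | zero =>
      rw [map_zero]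
      exact zero_mem _
    | add y z hy hz =>
      rw [map_add]
      exact add_mem hy hz
    | tmul r y =>
      have hy : P.freeLift W h.le_deg y ∈ generated W := by
        rw [generated, ← freeLift_range h.le_deg]
        exact ⟨y, rfl⟩
      obtain ⟨n, hn⟩ := h.generated_le hy
      rw [← B_span] at hn
      have := image_mul (⋃ n, B n) (i r * P.freeLift W h.le_deg y)
        (Submodule.mul_mem_mul ⟨r, rfl⟩ (Submodule.span_mono (Set.subset_iUnion B n) hn))
      refine Submodule.span_mono ?_ this
      exact fun y hy => ⟨⟨y, hy⟩, rfl⟩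
  let e := Module.Basis.mk (h.linearIndependent hB B_li) hspan
  have he : ∀ b : ↥(⋃ n, B n), e b = (show i.dgModule from b.1) := fun b =>
    Module.Basis.mk_apply _ _ b
  have hex : ∀ b : ↥(⋃ n, B n), ∃ n, b.1 ∈ B n := fun b => Set.mem_iUnion.1 b.2
  -- The level is the first stage whose basis contains `b`. It is positive since stage `0` is empty,
  -- and the differential lands in the `R`-span of the preceding stage.
  refine ⟨↥(⋃ n, B n), e, fun b => Nat.find (hex b), fun b => ?_, fun b => ?_⟩
  · obtain ⟨n, hn⟩ := hex b
    obtain ⟨k, hk⟩ := B_hom n b.1 hn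
    exact ⟨k, (he b).symm ▸ hk⟩
  · rw [he]
    have hb := Nat.find_spec (hex b)
    cases hl : Nat.find (hex b) with
    | zero =>
      rw [hl, B_zero] at hb
      exact absurd hb (Set.notMem_empty _)
    | succ n =>
      rw [hl] at hb
      have hb' : b.1 ∈ filtration i W (n + 1) := by
        rw [← B_span]
        exact Submodule.subset_span hb
      have hd : P.d b.1 ∈ i.image * Submodule.span ℚ (B n) := by
        rw [B_span]
        exact hb'.2
      refine Submodule.span_mono ?_ (image_mul (B n) _ hd)
      intro x hx
      refine ⟨⟨x, Set.mem_iUnion.2 ⟨n, hx⟩⟩, ?_, he _⟩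
      change Nat.find (hex ⟨x, _⟩) < Nat.find (hex b)
      rw [hl]
      exact Nat.lt_succ_of_le (Nat.find_min' (hex ⟨x, _⟩) hx)

end IsRelativeSullivan

end CDGA

/-! ### The diagonal class and restriction to `R`. -/

namespace CDGA

open DGModule

variable {A : CDGA.{u}}

/-- Graded commutativity, in terms of `twist`. -/
theorem mul_eq_twist_mul {k : ℤ} {x : A} (hx : x ∈ A.deg k) (y : A) :
    x * y = A.twist k y * x := by
  refine linearMap_ext_graded (ℳ := A.deg) (f := LinearMap.mulLeft ℚ x)
    (g := LinearMap.mulRight ℚ x ∘ₗ A.twist k) (fun n y hy => ?_) y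
  rw [LinearMap.mulLeft_apply, LinearMap.comp_apply, LinearMap.mulRight_apply,
    twist_of_mem k hy, units_smul_mul]
  exact A.comm hx hy

theorem mul_apply_tmul (x y : A) : A.mul (tmul A A x y) = x * y := rfl

section DiagonalClass

variable {m : ℕ} {u : A →ₗ[ℚ] ℚ} {J : Type w} [Fintype J] (E : DualBases A m u J)

theorem DualBases.T_eq :
    E.T = ∑ j, (E.p j).negOnePow • tmul A A (E.a j) (E.b j) := rfl

theorem DualBases.d_T : (A.tensor A).d E.T = 0 := by
  rw [E.T_eq, map_sum]
  exact Finset.sum_eq_zero fun j _ => by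
    rw [map_units_smul, d_tmul_eq_zero (E.d_a j) (E.d_b j), smul_zero]

/-- Only the `j`-th term of `T` survives. With `q = m - p_j` its sign is `(-1)^{p_j + q^2}`, which
is `(-1)^m` because `q^2 - q` is even. -/
theorem DualBases.functional_T_mul (j k : J) :
    tensorFunctional u u (E.T * tmul A A (E.b j) (E.b k)) =
      (m : ℤ).negOnePow • u (E.b j * E.b k) := by
  rw [E.T_eq, Finset.sum_mul, map_sum, Finset.sum_eq_single j]
  · rw [units_smul_mul, map_units_smul, tensorFunctional_mul u u _ _ (E.b_mem j) (E.b_mem j),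
      E.pairing_self, one_mul, smul_smul, ← Int.negOnePow_add]
    congr 1
    obtain ⟨c, hc⟩ := Int.even_mul_succ_self ((m : ℤ) - E.p j - 1)
    exact negOnePow_congr c (by rw [← hc]; ring)
  · intro l _ hl
    rw [units_smul_mul, map_units_smul, tensorFunctional_mul u u _ _ (E.b_mem l) (E.b_mem j),
      E.pairing_ne l j hl, zero_mul, smul_zero, smul_zero]
  · simp

end DiagonalClass

variable {P : CDGA.{v}} {i : (A.tensor A).Hom P} {W : ℤ → Submodule ℚ P} {φ : P.Hom A}

/-- A relative Sullivan model of the multiplication is a semifree resolution. -/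
theorem IsMulModel.isSemifreeResolution (h : IsMulModel i W φ) :
    IsSemifreeResolution (M := i.dgModule) (N := A.mul.dgModule) φ.toLinearMap := by
  refine ⟨h.relative.isSemifree, ⟨⟨fun n x hx => ?_, fun p r hr x => ?_⟩, ?_⟩, h.quasiIso⟩
  · rw [add_zero]
    exact φ.map_deg hx
  · rw [zero_mul, Int.negOnePow_zero, one_smul]
    have : φ (i r * (show P from x)) = A.mul r * φ (show P from x) := by rw [map_mul, h.comm]
    exact this
  · refine LinearMap.ext fun x => sub_eq_zero.2 ?_
    rw [Int.negOnePow_zero, one_smul]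
    exact (φ.map_d x).symm

section Restriction

variable {m : ℕ} {f : i.dgModule →ₗ[ℚ] (A.tensor A).self}

/-- The value at `1` of a map from `P` to `R`. -/
noncomputable def valueAtOne (f : i.dgModule →ₗ[ℚ] (A.tensor A).self) : A.tensor A :=
  f (show i.dgModule from (1 : P))

/-- As `i z = z • 1`, linearity determines `f` on the image of `R` by its value at `1`. -/
theorem apply_eq_twist_mul (hf : f ∈ i.dgModule.homDeg (A.tensor A).self m) (z : A.tensor A) :
    (show A.tensor A from f (show i.dgModule from i z)) =
      (A.tensor A).twist m z * valueAtOne f := by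
  have h := homDeg_twist hf z (show i.dgModule from (1 : P))
  have e : z • (show i.dgModule from (1 : P)) = (show i.dgModule from i z) := mul_one (i z)
  rw [e] at h
  exact h

theorem valueAtOne_mem (hf : f ∈ i.dgModule.homDeg (A.tensor A).self m) :
    valueAtOne f ∈ (A.tensor A).deg m := by
  have := hf.1 0 (show i.dgModule from (1 : P))
    (show (1 : P) ∈ P.deg 0 from SetLike.GradedOne.one_mem)
  rw [zero_add] at this
  exact this

theorem d_valueAtOne (hf : f ∈ i.dgModule.morphisms (A.tensor A).self m) :
    (A.tensor A).d (valueAtOne f) = 0 := by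
  have h := morphisms_d hf (show i.dgModule from (1 : P))
  have e : i.dgModule.d (show i.dgModule from (1 : P)) = 0 := P.d_one
  rw [e, map_zero, smul_zero] at h
  exact h

/-- The restriction of `f` to `R` is the multiplication by `T` if and only if `T` represents the
class of `f 1`. -/
theorem restrictsToMul_iff (hf : f ∈ i.dgModule.homDeg (A.tensor A).self m) {T : A.tensor A} :
    i.RestrictsToMul T f ↔ valueAtOne f - T ∈ LinearMap.range (A.tensor A).d := by
  constructor
  · intro h
    have := h 1 (d_one)
    rw [apply_eq_twist_mul hf, twist_one, one_mul, mul_one] at this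
    exact this
  · rintro ⟨y, hy⟩ z hz
    refine ⟨y * z, ?_⟩
    -- Because `f 1` has degree `m`, graded commutativity turns `± z * f 1` into `f 1 * z`.
    rw [d_mul, hy, hz, mul_zero, add_zero, sub_mul, apply_eq_twist_mul hf,
      mul_eq_twist_mul (valueAtOne_mem hf)]

end Restriction

end CDGA

/-! ### The main theorem. -/

open CDGA in
theorem theorem1 (A : CDGA.{u}) (V : ℤ → Submodule ℚ A) (hV : A.IsSullivanModel V)
    (m : ℕ) (u : A →ₗ[ℚ] ℚ) (hu : A.IsPoincareDuality m u)
    (J : Type w) [Fintype J] (E : CDGA.DualBases A m u J)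
    (P : CDGA.{v}) (i : (A.tensor A).Hom P) (W : ℤ → Submodule ℚ P) (φ : P.Hom A)
    (hP : CDGA.IsMulModel i W φ) :
    -- existence and uniqueness up to homotopy
    (∃ f ∈ i.dgModule.morphisms (A.tensor A).self m,
      i.RestrictsToMul E.T f ∧
      ∀ g ∈ i.dgModule.morphisms (A.tensor A).self m,
        i.RestrictsToMul E.T g → DGModule.Homotopic m f g) ∧
    -- `Ext^m` is one-dimensional, computed with the relative Sullivan model
    Nonempty (i.dgModule.homCohomology (A.tensor A).self m ≃ₗ[ℚ] ℚ) ∧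
    -- `Ext^m` is one-dimensional, computed with an arbitrary semifree resolution of `∧V`
    (∀ (Q : DGModule.{u, x} (A.tensor A)) (ψ : Q →ₗ[ℚ] A.mul.dgModule),
      DGModule.IsSemifreeResolution ψ →
        Nonempty (Q.homCohomology (A.tensor A).self m ≃ₗ[ℚ] ℚ)) := by
  obtain ⟨C, -, hCβ, -⟩ := E.exists_contraction hu
  have D := C.tensor C
  have hφ := hP.isSemifreeResolution
  refine ⟨?_, DGModule.nonempty_homCohomology_equiv hV hu hφ D,
    fun Q ψ hψ => DGModule.nonempty_homCohomology_equiv hV hu hψ D⟩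
  -- The factor `(-1)^m` is the sign in `functional_T_mul`.
  obtain ⟨f, hf, hfx⟩ := DGModule.exists_morphism_apply_eq hu hφ D (((m : ℤ).negOnePow : ℤ) : ℚ)
  have hfT : i.RestrictsToMul E.T f := by
    -- The cocycle `f 1 - T` is orthogonal to all `b j ⊗ b k`, so duality in `R` makes it a
    -- coboundary.
    refine (restrictsToMul_iff hf.1).2 ⟨(C.tensor C).S (valueAtOne f - E.T),
      (C.tensor C).d_S_eq ?_ fun k => ?_⟩
    · rw [map_sub, d_valueAtOne hf, E.d_T, sub_zero]
    · have hβ : (C.tensor C).β k = tmul A A (E.b k.1) (E.b k.2) := by rw [← hCβ]; rfl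
      have h1 : P.d (i (tmul A A (E.b k.1) (E.b k.2))) = 0 :=
        (i.map_d _).symm.trans (by
          rw [d_tmul_eq_zero (E.d_b k.1) (E.d_b k.2)]
          exact map_zero i.toAlgHom)
      have h2 : tensorFunctional u u (show A.tensor A from
          f (show i.dgModule from i (tmul A A (E.b k.1) (E.b k.2)))) =
            (((m : ℤ).negOnePow : ℤ) : ℚ) * u (φ (i (tmul A A (E.b k.1) (E.b k.2)))) := hfx _ h1
      rw [apply_eq_twist_mul hf.1, ← mul_eq_twist_mul (valueAtOne_mem hf.1), hP.comm,
        mul_apply_tmul] at h2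
      rw [hβ, sub_mul, map_sub, h2, E.functional_T_mul, Units.smul_def, zsmul_eq_mul, sub_self]
  refine ⟨f, hf, hfT, fun g hg hgT => ?_⟩
  obtain ⟨a, ha, hda, hua⟩ := hV.exists_fundamental hu
  obtain ⟨y, hy⟩ := (restrictsToMul_iff hf.1).1 hfT
  obtain ⟨z, hz⟩ := (restrictsToMul_iff hg.1).1 hgT
  have hfg : f - g ∈ i.dgModule.morphisms (A.tensor A).self m := sub_mem hf hg
  have hval : valueAtOne (f - g) = (A.tensor A).d (y - z) := by
    rw [map_sub, hy, hz, sub_sub_sub_cancel_right]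
    rfl
  -- The cocycle `i (a ⊗ 1)` lies over `a`, so it may serve as the test cocycle `x₀`.
  have hda1 : (A.tensor A).d (tmul A A a 1) = 0 := d_tmul_eq_zero hda d_one
  have hx₀ : P.d (i (tmul A A a 1)) = 0 :=
    (i.map_d _).symm.trans (by rw [hda1]; exact map_zero i.toAlgHom)
  have hax : a - φ (i (tmul A A a 1)) ∈ LinearMap.range A.d := by
    rw [hP.comm, mul_apply_tmul, mul_one, sub_self]
    exact zero_mem _
  -- The value is a cocycle times a coboundary, which `u ⊗ u` kills by integration by parts.
  have hU : tensorFunctional u u (show A.tensor A from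
      (f - g) (show i.dgModule from i (tmul A A a 1))) = 0 := by
    rw [apply_eq_twist_mul hfg.1, hval, ← cycle_mul D.cycle, d_twist, hda1]
    simp
  obtain ⟨h, hh, e⟩ :=
    (DGModule.mem_coboundaries_iff hV hu hφ hfg D hx₀ ha hda hua hax).2 hU
  exact ⟨h, hh, e.symm⟩
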